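/- **Setting.** Let $F\in C^1(\mathbb R^n\times\mathbb R^m;\mathbb R^n)$ with $F(0,0)=0$ and, for some $L_F>0$, $\|F(x_1,u_1)-F(x_2,u_2)\|\le L_F(\|x_1-x_2\|+\|u_1-u_2\|)$ for all $x_i,u_i$ (Euclidean norms). For $T\ge 0$ let $\mathcal U_T$ be the set of essentially bounded measurable inputs $\tilde u:[0,T]\to\mathbb R^m$; for $x_0\in\mathbb R^n$ the system trajectory $(\tilde x,\tilde u)$ is given by the absolutely continuous solution of $\dot{\tilde x}=F(\tilde x,\tilde u)$, $\tilde x(0)=x_0$ on $[0,T]$. Let $$J_T(\tilde u;x_0)=\int_0^T \big(Q(\tilde x(t))+R(\tilde u(t))\big)\,dt+V(\tilde x(T)),$$ where $Q,V:\mathbb R^n\to\mathbb R$ and $R:\mathbb R^m\to\mathbb R$ are $C^2$, vanish together with their gradients at the origin, and satisfy $\alpha_Q I\preceq\nabla^2Q\preceq\beta_Q I$, $\alpha_R I\preceq\nabla^2R\preceq\beta_R I$, $\alpha_V I\preceq\nabla^2V\preceq\beta_V I$ everywhere, with $0<\alpha_Q\le\beta_Q$, $0<\alpha_R\le\beta_R$,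 $0\le\alpha_V\le\beta_V$. An input $\tilde u\in\mathcal U_T$ is an $\epsilon$-first-order stationary point ($\epsilon$-FOS) of $J_T(\cdot;x_0)$ if $\|\nabla J_T(\tilde u;x_0)\|_{L^2([0,T])}\le\epsilon$, where the gradient $\nabla J_T(\tilde u;x_0)\in L^2([0,T];\mathbb R^m)$ represents the directional derivatives of $J_T(\cdot;x_0)$ at $\tilde u$ in all directions of $\mathcal U_T$ through the $L^2$ inner product. Along a system trajectory $(\tilde x,\tilde u)$ on $[0,T]$ put $\tilde A(t)=\partial_xF(\tilde x(t),\tilde u(t))$, $\tilde B(t)=\partial_uF(\tilde x(t),\tilde u(t))$ and $\tilde d(t)=F(\tilde x(t),\tilde u(t))-\tilde A(t)\tilde x(t)-\tilde B(t)\tilde u(t)$; let $\tilde B^\dagger$ be the Moore–Penrose pseudoinverse. A linear system $(A(\cdot),B(\cdot))$ on $[0,T]$ is *$\gamma$-stabilizable* if for all $s\in[0,T]$ and $\xi\in\mathbb R^n$ $$\inf_{\hat u}\ \int_s^T\big(\|\hat x(t)\|^2+\|\hat u(t)\|^2\big)\,dt+\|\hat x(T)\|^2\le\gamma\|\xi\|^2,\qquad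 \dot{\hat x}=A\hat x+B\hat u,\ \hat x(s)=\xi,$$ the infimum being over essentially bounded measurable $\hat u:[s,T]\to\mathbb R^m$. **Theorem.** Let $\gamma,L_x,L_u>0$ and suppose that for every $T\ge0$, $x_0\in\mathbb R^n$ and $\tilde u\in\mathcal U_T$, along the resulting trajectory, (i) $\tilde d(t)\in\mathrm{range}(\tilde B(t))$ for all $t\in[0,T]$; (ii) $(\tilde A(\cdot),\tilde B(\cdot))$ is $\gamma$-stabilizable; (iii) $\|\tilde B^\dagger(t)\tilde d(t)\|\le L_x\|\tilde x(t)\|+L_u\|\tilde u(t)\|$ for all $t\in[0,T]$; and suppose that (iv) $L_u^2\le\frac{\alpha_R}{8\beta_R}$ and $L_x^2\le\frac{\alpha_Q}{8\beta_R}$. Set $$\mathcal C_0=6L_F+\tfrac{2L_F\alpha_Q}{\alpha_R}+\tfrac{2\alpha_Q}{\alpha_V},\quad \mathcal C_1=\tfrac{4\gamma}{\alpha_Q}\max\{\beta_V,\beta_R,\beta_Q\},\quad \mathcal C_2=\tfrac{1}{2\alpha_Q\alpha_R}\Big(1+8\beta_R\max\big\{\tfrac{L_x^2}{\alpha_Q},\tfrac{L_u^2}{\alpha_R}\big\}\Big),$$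 $$\mathcal C_0^\delta=6L_F+\tfrac{2L_F\alpha_Q}{\alpha_R}+\min\big\{\tfrac2\delta,\tfrac{2\alpha_Q}{\alpha_R}\big\},\qquad \mathcal C_1^\delta=e^{\delta/\mathcal C_1}\mathcal C_1 .$$ Then for every $T\ge0$, $x_0\in\mathbb R^n$, $\epsilon$, and every $\tilde u\in\mathcal U_T$ that is an $\epsilon$-FOS of $J_T(\cdot;x_0)$, with trajectory $\tilde x$: 1. if $\alpha_V>0$, then for all $s\in[0,T]$: $\ \|\tilde x(s)\|^2\le\mathcal C_0\big(\mathcal C_1e^{-s/\mathcal C_1}\|x_0\|^2+\mathcal C_2\epsilon^2\big)$; 2. for any $\alpha_V\ge0$, for all $s\in[0,T]$ and all $\delta>0$: $\ \|\tilde x(s)\|^2\le\mathcal C_0^\delta\big(\mathcal C_1^\delta e^{-s/\mathcal C_1}\|x_0\|^2+\mathcal C_2\epsilon^2\big)$. -/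

import Mathlib

open MeasureTheory Set
open scoped ENNReal

noncomputable section

/-- The state (or input) space: `ℝᵏ` with the Euclidean norm. -/
abbrev Euc (k : ℕ) : Type := EuclideanSpace ℝ (Fin k)

/-! ### Moore–Penrose pseudoinverse -/

/-- `B` restricted to a map from the orthogonal complement of its kernel to its range. -/
def coreMap {n m : ℕ} (B : Euc m →L[ℝ] Euc n) :
    (LinearMap.ker B.toLinearMap)ᗮ →ₗ[ℝ] LinearMap.range B.toLinearMap :=
  B.toLinearMap.rangeRestrict.comp (LinearMap.ker B.toLinearMap)ᗮ.subtype

theorem coreMap_bijective {n m : ℕ} (B : Euc m →L[ℝ] Euc n) :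
    Function.Bijective (coreMap B) := by
  constructor
  · rw [← LinearMap.ker_eq_bot, LinearMap.ker_eq_bot']
    rintro ⟨v, hv⟩ h
    have h1 : B v = 0 := congrArg Subtype.val h
    have h2 : v ∈ LinearMap.ker B.toLinearMap := h1
    have h3 : inner ℝ v v = (0 : ℝ) := (Submodule.mem_orthogonal _ v).1 hv v h2
    exact Subtype.ext (inner_self_eq_zero.1 h3)
  · rintro ⟨y, v, rfl⟩
    refine ⟨(LinearMap.ker B.toLinearMap)ᗮ.orthogonalProjectionOnto v, Subtype.ext ?_⟩
    have h1 : v - (LinearMap.ker B.toLinearMap)ᗮ.orthogonalProjectionOnto v ∈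
        (LinearMap.ker B.toLinearMap)ᗮᗮ :=
      Submodule.sub_starProjection_mem_orthogonal v
    rw [Submodule.orthogonal_orthogonal] at h1
    have h2 : B (v - (LinearMap.ker B.toLinearMap)ᗮ.orthogonalProjectionOnto v) = 0 := h1
    rw [map_sub, sub_eq_zero] at h2
    exact h2.symm

/-- The Moore–Penrose pseudoinverse `B†`: project orthogonally onto `range B`, then invert
the bijection `(ker B)ᗮ → range B`. -/
def pinv {n m : ℕ} (B : Euc m →L[ℝ] Euc n) : Euc n →ₗ[ℝ] Euc m :=
  (LinearMap.ker B.toLinearMap)ᗮ.subtype ∘ₗ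
    (LinearEquiv.ofBijective (coreMap B) (coreMap_bijective B)).symm.toLinearMap ∘ₗ
      (LinearMap.range B.toLinearMap).orthogonalProjectionOnto.toLinearMap

/-! ### Inputs, trajectories and linearizations -/

/-- Admissible inputs on `[a, b]`: measurable and essentially bounded
(hence also square integrable). -/
def AdmissibleInput {m : ℕ} (a b : ℝ) (u : ℝ → Euc m) : Prop :=
  MemLp u ∞ (volume.restrict (Icc a b))

/-- `x` is a (Carathéodory) solution on `[a, b]` of `ẋ(t) = f(t, x(t))`, `x(a) = ξ`. -/
structure IsSolution {n : ℕ} (f : ℝ → Euc n → Euc n) (a b : ℝ) (ξ : Euc n)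
    (x : ℝ → Euc n) : Prop where
  continuousOn : ContinuousOn x (Icc a b)
  integrable : IntervalIntegrable (fun τ => f τ (x τ)) volume a b
  eq_integral : ∀ t ∈ Icc a b, x t = ξ + ∫ τ in a..t, f τ (x τ)

/-- `x` is the state trajectory on `[0, T]` of `ẋ = F(x, u)`, `x(0) = x₀`. -/
def IsTrajectory {n m : ℕ} (F : Euc n × Euc m → Euc n) (T : ℝ) (x₀ : Euc n)
    (u : ℝ → Euc m) (x : ℝ → Euc n) : Prop :=
  IsSolution (fun τ y => F (y, u τ)) 0 T x₀ x

/-- `Ã = ∂F/∂x` at `(x, u)`. -/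
def jacA {n m : ℕ} (F : Euc n × Euc m → Euc n) (x : Euc n) (u : Euc m) : Euc n →L[ℝ] Euc n :=
  fderiv ℝ (fun y => F (y, u)) x

/-- `B̃ = ∂F/∂u` at `(x, u)`. -/
def jacB {n m : ℕ} (F : Euc n × Euc m → Euc n) (x : Euc n) (u : Euc m) : Euc m →L[ℝ] Euc n :=
  fderiv ℝ (fun v => F (x, v)) u

/-- The drift `d̃ = F(x, u) - Ã x - B̃ u`. -/
def drift {n m : ℕ} (F : Euc n × Euc m → Euc n) (x : Euc n) (u : Euc m) : Euc n :=
  F (x, u) - jacA F x u x - jacB F x u u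

/-- `γ`-stabilizability of the linear time-varying system `(A(·), B(·))` on `[0, T]`.
The infimum is taken in `EReal`, over admissible inputs `v` and the trajectories `z` they
generate from `z(s) = ξ`. -/
def IsStabilizable {n m : ℕ} (γ T : ℝ) (A : ℝ → Euc n →L[ℝ] Euc n)
    (B : ℝ → Euc m →L[ℝ] Euc n) : Prop :=
  ∀ s ∈ Icc 0 T, ∀ ξ : Euc n,
    (⨅ (v : ℝ → Euc m) (z : ℝ → Euc n) (_ : AdmissibleInput s T v)
        (_ : IsSolution (fun τ y => A τ y + B τ (v τ)) s T ξ z),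
      (((∫ t in s..T, (‖z t‖ ^ 2 + ‖v t‖ ^ 2)) + ‖z T‖ ^ 2 : ℝ) : EReal))
    ≤ ((γ * ‖ξ‖ ^ 2 : ℝ) : EReal)

/-! ### Costs and stationary points -/

/-- `ℓ` is `C²`, is minimized at the origin with value `0`, and `α I ⪯ ∇²ℓ ⪯ β I`. -/
structure IsCost {k : ℕ} (α β : ℝ) (ℓ : Euc k → ℝ) : Prop where
  contDiff : ContDiff ℝ 2 ℓ
  map_zero : ℓ 0 = 0
  fderiv_zero : fderiv ℝ ℓ 0 = 0
  le_hessian : ∀ x v, α * ‖v‖ ^ 2 ≤ fderiv ℝ (fderiv ℝ ℓ) x v v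
  hessian_le : ∀ x v, fderiv ℝ (fderiv ℝ ℓ) x v v ≤ β * ‖v‖ ^ 2

open Classical in
/-- The state trajectory on `[0, T]` generated by the input `u` from `x₀` (determined on `[0, T]`
when `F` is globally Lipschitz and `u` is admissible; the default value is then never used). -/
def stateTraj {n m : ℕ} (F : Euc n × Euc m → Euc n) (T : ℝ) (x₀ : Euc n)
    (u : ℝ → Euc m) : ℝ → Euc n :=
  if h : ∃ x, IsTrajectory F T x₀ u x then h.choose else 0

/-- `J_T(u; x₀) = ∫₀ᵀ (Q(x(t)) + R(u(t))) dt + V(x(T))`. -/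
def cost {n m : ℕ} (F : Euc n × Euc m → Euc n) (Q : Euc n → ℝ) (R : Euc m → ℝ)
    (V : Euc n → ℝ) (T : ℝ) (x₀ : Euc n) (u : ℝ → Euc m) : ℝ :=
  (∫ t in (0 : ℝ)..T, (Q (stateTraj F T x₀ u t) + R (u t))) + V (stateTraj F T x₀ u T)

/-- `g` is the `L²([0, T])`-gradient at `u` of the functional `J` on admissible inputs. -/
structure IsL2Gradient {m : ℕ} (T : ℝ) (J : (ℝ → Euc m) → ℝ) (u g : ℝ → Euc m) : Prop where
  memLp : MemLp g 2 (volume.restrict (Icc 0 T))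
  hasDerivAt : ∀ h : ℝ → Euc m, AdmissibleInput 0 T h →
    HasDerivAt (fun η : ℝ => J (u + η • h)) (∫ t in (0 : ℝ)..T, inner ℝ (g t) (h t)) 0

/-- `u` is an `ε`-approximate first-order stationary point of `J`: `‖∇J(u)‖_{L²} ≤ ε`. -/
def IsFOS {m : ℕ} (T ε : ℝ) (J : (ℝ → Euc m) → ℝ) (u : ℝ → Euc m) : Prop :=
  AdmissibleInput 0 T u ∧
    ∃ g, IsL2Gradient T J u g ∧ (eLpNorm g 2 (volume.restrict (Icc 0 T))).toReal ≤ ε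

/-! ### The constants of the bound -/

def constC0 (LF αQ αR αV : ℝ) : ℝ := 6 * LF + 2 * LF * αQ / αR + 2 * αQ / αV

def constC0δ (LF αQ αR δ : ℝ) : ℝ := 6 * LF + 2 * LF * αQ / αR + min (2 / δ) (2 * αQ / αR)

def constC1 (γ αQ βQ βR βV : ℝ) : ℝ := 4 * γ * max βV (max βR βQ) / αQ

def constC2 (αQ αR βR Lx Lu : ℝ) : ℝ :=
  1 / (2 * αR * αQ) * (1 + 8 * βR * max (Lx ^ 2 / αQ) (Lu ^ 2 / αR))

end

open Filter Topology

/-! ### Second-order Taylor bounds for the costs -/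

/-! The cost-to-go along a stationary trajectory is compared with that of a linearized problem, and
the resulting energy bound is turned into exponential decay by Gronwall.

Along `(x, u)` let `A`, `B` be the Jacobians; by matching, the drift is `B p` with `p = B† d`, so `ẋ
= A x + B (u + p)`. If `ẏ = A y + B v` with `y(s) = x(s)`, then `y - x` is exactly the first
variation of the state in the input direction `h = v - p - u` switched on after time `s`. The
derivative of the cost in this direction is `⟨∇J, h⟩`. Convexity of `Q`, `V` and strong convexity of
`R` bound it by the difference of the two costs-to-go minus `αR/2 ‖h‖²`, and Young's inequality
absorbs `⟨∇J, h⟩`. Hence `(x, u)` costs at most `ε²/(2αR)` more than `(y, v - p)`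
(`cost_le_linearized_cost`, resting on `hasDerivAt_stateTraj`).

Stabilizability supplies a `v` of quadratic cost close to `γ‖x(s)‖²`, and smallness of `Lx`, `Lu`
lets the contribution of `p` be absorbed on the left. With `w = ‖x‖² + (αR/αQ)‖u‖²` this gives `∫ₛᵀ
w + (αV/αQ)‖x(T)‖² ≤ C₁‖x(s)‖² + 2C₂ε²` (`energy_le`). Since `‖x‖² ≤ w` and `-w` is the derivative
of the left side, that tail energy decays like `e^{-s/C₁}` down to the level `2C₂ε²`
(`tail_integral_le_exp_decay`).

Energy becomes a pointwise bound because `‖x‖²` varies at rate at most `K w`. If `αV > 0`, integrate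
back from `T`, where the terminal term controls `‖x(T)‖²`. In general, average over a window ending
at `s`, of length `δ` or `αR/αQ`, whichever gives the smaller constant. If the window does not fit
in `[0, s]`, integrate from `0`; the constants still suffice because stabilizability itself bounds
`γ` below. -/

theorem second_order_lower_bound {φ dφ ddφ : ℝ → ℝ} {c : ℝ}
    (h1 : ∀ t, HasDerivAt φ (dφ t) t) (h2 : ∀ t, HasDerivAt dφ (ddφ t) t)
    (hc : ∀ t, c ≤ ddφ t) : φ 0 + dφ 0 + c / 2 ≤ φ 1 := by
  have hmono : Monotone fun t => dφ t - c * t := by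
    refine monotone_of_hasDerivAt_nonneg (f' := fun t => ddφ t - c * 1)
      (fun t => (h2 t).sub ((hasDerivAt_id t).const_mul c)) fun t => ?_
    simpa using hc t
  have hd : ∀ t, HasDerivAt (fun t => φ t - dφ 0 * t - c / 2 * t ^ 2)
      (dφ t - dφ 0 * 1 - c / 2 * (2 * t)) t := fun t => by
    have h2 := (hasDerivAt_pow 2 t).const_mul (c / 2)
    simp only [Nat.cast_ofNat, Nat.add_one_sub_one, pow_one] at h2
    exact ((h1 t).sub ((hasDerivAt_id t).const_mul (dφ 0))).sub h2
  have hm : MonotoneOn (fun t => φ t - dφ 0 * t - c / 2 * t ^ 2) (Icc 0 1) := by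
    refine monotoneOn_of_hasDerivWithinAt_nonneg (convex_Icc 0 1)
      (fun t _ => (hd t).continuousAt.continuousWithinAt) (fun t _ => (hd t).hasDerivWithinAt) ?_
    intro t ht
    rw [interior_Icc] at ht
    have := hmono ht.1.le
    simp only [mul_zero, sub_zero] at this
    linarith
  have := hm (left_mem_Icc.2 zero_le_one) (right_mem_Icc.2 zero_le_one) zero_le_one
  simp only [mul_zero, sub_zero, mul_one, one_pow] at this
  norm_num at this
  linarith

namespace IsCost

variable {k : ℕ} {α β : ℝ} {ℓ : Euc k → ℝ}

theorem hasFDerivAt (h : IsCost α β ℓ) (x : Euc k) : HasFDerivAt ℓ (fderiv ℝ ℓ x) x :=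
  (h.contDiff.differentiable (by norm_num) x).hasFDerivAt

theorem continuous_fderiv (h : IsCost α β ℓ) : Continuous (fderiv ℝ ℓ) :=
  h.contDiff.continuous_fderiv (by norm_num)

theorem hasDerivAt_line (h : IsCost α β ℓ) (x v : Euc k) (t : ℝ) :
    HasDerivAt (fun t : ℝ => ℓ (x + t • v)) (fderiv ℝ ℓ (x + t • v) v) t := by
  have hl : HasDerivAt (fun t : ℝ => x + t • v) v t := by
    simpa using ((hasDerivAt_id t).smul_const v).const_add x
  exact (h.hasFDerivAt _).comp_hasDerivAt t hl

theorem hasDerivAt_fderiv_line (h : IsCost α β ℓ) (x v : Euc k) (t : ℝ) :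
    HasDerivAt (fun t : ℝ => fderiv ℝ ℓ (x + t • v) v)
      (fderiv ℝ (fderiv ℝ ℓ) (x + t • v) v v) t := by
  have hl : HasDerivAt (fun t : ℝ => x + t • v) v t := by
    simpa using ((hasDerivAt_id t).smul_const v).const_add x
  have h2 : HasFDerivAt (fderiv ℝ ℓ) (fderiv ℝ (fderiv ℝ ℓ) (x + t • v)) (x + t • v) :=
    ((h.contDiff.fderiv_right (m := 1) (by norm_num)).differentiable
      (by norm_num) _).hasFDerivAt
  have h3 := h2.comp_hasDerivAt t hl
  simpa using h3.clm_apply (hasDerivAt_const t v)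

theorem lower_bound (h : IsCost α β ℓ) (x y : Euc k) :
    ℓ x + fderiv ℝ ℓ x (y - x) + α / 2 * ‖y - x‖ ^ 2 ≤ ℓ y := by
  have := second_order_lower_bound (c := α * ‖y - x‖ ^ 2) (h.hasDerivAt_line x (y - x))
    (h.hasDerivAt_fderiv_line x (y - x)) fun t => h.le_hessian _ _
  simp only [zero_smul, add_zero, one_smul, add_sub_cancel] at this
  linarith

theorem le_at (h : IsCost α β ℓ) (y : Euc k) : α / 2 * ‖y‖ ^ 2 ≤ ℓ y := by
  simpa [h.map_zero, h.fderiv_zero] using h.lower_bound 0 y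

theorem at_le (h : IsCost α β ℓ) (y : Euc k) : ℓ y ≤ β / 2 * ‖y‖ ^ 2 := by
  have := second_order_lower_bound (c := -(β * ‖y‖ ^ 2))
    (fun t => (h.hasDerivAt_line 0 y t).neg)
    (fun t => (h.hasDerivAt_fderiv_line 0 y t).neg) fun t => neg_le_neg (h.hessian_le _ _)
  simp [h.map_zero, h.fderiv_zero] at this
  linarith

end IsCost

/-! ### The integral Gronwall inequality -/

theorem hasDerivWithinAt_integral_Icc {E : Type*} [NormedAddCommGroup E] [NormedSpace ℝ E]
    [CompleteSpace E] {φ : ℝ → E} {a b : ℝ} (hφ : ContinuousOn φ (Icc a b)) {t : ℝ}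
    (ht : t ∈ Icc a b) :
    HasDerivWithinAt (fun t => ∫ τ in a..t, φ τ) (φ t) (Icc a b) t := by
  have hab : a ≤ b := ht.1.trans ht.2
  have : Fact (t ∈ Icc a b) := ⟨ht⟩
  have hi : IntervalIntegrable φ volume a t :=
    (hφ.mono (by rw [uIcc_of_le ht.1]; exact Icc_subset_Icc_right ht.2)).intervalIntegrable
  exact intervalIntegral.integral_hasDerivWithinAt_right hi
    (hφ.stronglyMeasurableAtFilter_nhdsWithin measurableSet_Icc t) (hφ t ht)

/-- The right-hand side of the hypothesis, multiplied by `exp (-L (t - a))`, is antitone. Neither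
`φ` nor `c` needs a sign, which the time-reversed version below relies on. -/
theorem le_mul_exp_of_le_add_integral {φ : ℝ → ℝ} {a b c L : ℝ} (hL : 0 ≤ L)
    (hφ : ContinuousOn φ (Icc a b))
    (h : ∀ t ∈ Icc a b, φ t ≤ c + L * ∫ τ in a..t, φ τ) :
    ∀ t ∈ Icc a b, φ t ≤ c * Real.exp (L * (t - a)) := by
  intro t ht
  have hab : a ≤ b := ht.1.trans ht.2
  set P : ℝ → ℝ := fun t => c + L * ∫ τ in a..t, φ τ with hP
  have hPd : ∀ s ∈ Icc a b, HasDerivWithinAt P (L * φ s) (Icc a b) s := fun s hs =>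
    ((hasDerivWithinAt_integral_Icc hφ hs).const_mul L).const_add c
  have hEd : ∀ s ∈ Icc a b, HasDerivWithinAt (fun s => Real.exp (-(L * (s - a))) * P s)
      (Real.exp (-(L * (s - a))) * (-(L * 1)) * P s
        + Real.exp (-(L * (s - a))) * (L * φ s)) (Icc a b) s := fun s hs => by
    have he : HasDerivAt (fun s => Real.exp (-(L * (s - a))))
        (Real.exp (-(L * (s - a))) * (-(L * 1))) s :=
      ((((hasDerivAt_id s).sub_const a).const_mul L).neg).exp
    exact he.hasDerivWithinAt.mul (hPd s hs)
  have hanti : AntitoneOn (fun s => Real.exp (-(L * (s - a))) * P s) (Icc a b) := by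
    refine antitoneOn_of_hasDerivWithinAt_nonpos (convex_Icc a b)
      (fun s hs => (hEd s hs).continuousWithinAt)
      (fun s hs => (hEd s (interior_subset hs)).mono interior_subset) ?_
    intro s hs
    have h1 := h s (interior_subset hs)
    have : Real.exp (-(L * (s - a))) * (-(L * 1)) * P s
        + Real.exp (-(L * (s - a))) * (L * φ s)
        = -(Real.exp (-(L * (s - a))) * L * (P s - φ s)) := by ring
    rw [this]
    have h2 : 0 ≤ P s - φ s := sub_nonneg.2 h1
    have := Real.exp_nonneg (-(L * (s - a)))
    have := mul_nonneg (mul_nonneg this hL) h2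
    linarith
  have h1 := hanti (left_mem_Icc.2 hab) ht ht.1
  simp only [sub_self, mul_zero, neg_zero, Real.exp_zero, one_mul] at h1
  have hPa : P a = c := by simp [hP]
  rw [hPa, Real.exp_neg, inv_mul_le_iff₀ (Real.exp_pos _)] at h1
  calc φ t ≤ P t := h t ht
    _ ≤ _ := by linarith

/-- Forward Gronwall applied to `-Y` run backwards from `t`. The integral hypothesis replaces `Y' ≤
-L Y`, so no differentiability of `Y` is needed. -/
theorem mul_exp_le_of_add_integral_le {Y : ℝ → ℝ} {t L : ℝ} (ht : 0 ≤ t) (hL : 0 ≤ L)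
    (hY : ContinuousOn Y (Icc 0 t))
    (h : ∀ s ∈ Icc 0 t, Y t + L * ∫ τ in s..t, Y τ ≤ Y s) :
    Y t * Real.exp (L * t) ≤ Y 0 := by
  have hm : ∀ s ∈ Icc 0 t, t - s ∈ Icc 0 t := fun s hs => ⟨by linarith [hs.2], by linarith [hs.1]⟩
  have := le_mul_exp_of_le_add_integral (φ := fun s => -Y (t - s)) (a := 0) (b := t)
    (c := -Y t) hL ((hY.comp (by fun_prop) hm).neg) (fun s hs => by
      have h1 := h (t - s) (hm s hs)
      rw [intervalIntegral.integral_neg, intervalIntegral.integral_comp_sub_left (fun s => Y s) t,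
        sub_zero]
      linarith) t ⟨ht, le_rfl⟩
  simp only [sub_self, sub_zero] at this
  linarith

/-! ### Bounded measurable functions of the state and the input -/

theorem AdmissibleInput.exists_bound {m : ℕ} {a b : ℝ} {u : ℝ → Euc m}
    (hu : AdmissibleInput a b u) :
    ∃ M, 0 ≤ M ∧ ∀ᵐ t ∂volume.restrict (Icc a b), ‖u t‖ ≤ M := by
  refine ⟨(eLpNormEssSup u (volume.restrict (Icc a b))).toReal, ENNReal.toReal_nonneg, ?_⟩
  have hb : eLpNormEssSup u (volume.restrict (Icc a b)) < ∞ := by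
    simpa [eLpNorm_exponent_top] using hu.2
  filter_upwards [ae_le_eLpNormEssSup (f := u) (μ := volume.restrict (Icc a b))] with t h1
  simpa using ENNReal.toReal_mono hb.ne h1

theorem memLp_top_comp {n m : ℕ} {E : Type*} [NormedAddCommGroup E]
    {G : Euc n × Euc m → E} (hG : Continuous G) {a b : ℝ} {x : ℝ → Euc n} {u : ℝ → Euc m}
    (hx : ContinuousOn x (Icc a b)) (hu : AdmissibleInput a b u) :
    MemLp (fun t => G (x t, u t)) ∞ (volume.restrict (Icc a b)) := by
  have hxm : AEStronglyMeasurable x (volume.restrict (Icc a b)) :=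
    hx.aestronglyMeasurable measurableSet_Icc
  obtain ⟨C, hC⟩ := isCompact_Icc.exists_bound_of_continuousOn hx
  obtain ⟨M, -, hM⟩ := hu.exists_bound
  have hK : IsCompact (Metric.closedBall (0 : Euc n) C ×ˢ Metric.closedBall (0 : Euc m) M) :=
    (isCompact_closedBall _ _).prod (isCompact_closedBall _ _)
  obtain ⟨D, hD⟩ := hK.exists_bound_of_continuousOn hG.continuousOn
  refine memLp_top_of_bound (hG.comp_aestronglyMeasurable (hxm.prodMk hu.1)) D ?_
  filter_upwards [hM, ae_restrict_mem measurableSet_Icc] with t h1 h2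
  exact hD _ ⟨mem_closedBall_zero_iff.2 (hC t h2), mem_closedBall_zero_iff.2 h1⟩

theorem MeasureTheory.MemLp.intervalIntegrable_of_top {E : Type*} [NormedAddCommGroup E]
    {f : ℝ → E} {a b : ℝ} (hf : MemLp f ∞ (volume.restrict (Icc a b))) {s t : ℝ}
    (hs : s ∈ Icc a b) (ht : t ∈ Icc a b) : IntervalIntegrable f volume s t := by
  have h : IntegrableOn f (Icc a b) := hf.integrable (by simp)
  exact (h.mono_set (ordConnected_Icc.uIcc_subset hs ht)).intervalIntegrable

theorem AdmissibleInput.mono {m : ℕ} {a b c d : ℝ} {u : ℝ → Euc m} (hu : AdmissibleInput a b u)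
    (h : Icc c d ⊆ Icc a b) : AdmissibleInput c d u :=
  hu.mono_measure (Measure.restrict_mono h le_rfl)

/-! ### Carathéodory solutions -/

/-- Gronwall for a perturbed linear growth bound. The forcing `e` enters only through its total
mass, so the estimate serves both for dependence on the input and for linearization remainders. -/
theorem norm_le_of_norm_deriv_le {n : ℕ} {E : Type*} [NormedAddCommGroup E] {a b L : ℝ}
    (hL : 0 ≤ L) {r : ℝ → Euc n} (hr : ContinuousOn r (Icc a b)) {k : ℝ → Euc n} {e : ℝ → E}
    (he : IntervalIntegrable e volume a b)
    (hrk : ∀ t ∈ Icc a b, r t = ∫ τ in a..t, k τ)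
    (hke : ∀ᵐ t ∂volume.restrict (Icc a b), ‖k t‖ ≤ L * ‖r t‖ + ‖e t‖) :
    ∀ t ∈ Icc a b, ‖r t‖ ≤ (∫ τ in a..b, ‖e τ‖) * Real.exp (L * (t - a)) := by
  refine le_mul_exp_of_le_add_integral (φ := fun t => ‖r t‖) hL hr.norm fun t ht => ?_
  have hsub : uIcc a t ⊆ uIcc a b := by
    rw [uIcc_of_le ht.1, uIcc_of_le (ht.1.trans ht.2)]; exact Icc_subset_Icc_right ht.2
  have hri : IntervalIntegrable (fun τ => ‖r τ‖) volume a t :=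
    (hr.norm.mono (by rw [uIcc_of_le ht.1]; exact Icc_subset_Icc_right ht.2)).intervalIntegrable
  have hei := (he.mono_set hsub).norm
  have h1 : ‖r t‖ ≤ ∫ τ in a..t, (L * ‖r τ‖ + ‖e τ‖) := by
    rw [hrk t ht]
    refine intervalIntegral.norm_integral_le_of_norm_le ht.1 ?_ ((hri.const_mul L).add hei)
    have := ae_imp_of_ae_restrict hke
    filter_upwards [this] with τ hτ hτ'
    exact hτ ⟨hτ'.1.le, hτ'.2.trans ht.2⟩
  rw [intervalIntegral.integral_add (hri.const_mul L) hei,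
    intervalIntegral.integral_const_mul] at h1
  have h2 : ∫ τ in a..t, ‖e τ‖ ≤ ∫ τ in a..b, ‖e τ‖ :=
    intervalIntegral.integral_mono_interval le_rfl ht.1 ht.2
      (Eventually.of_forall fun _ => norm_nonneg _) he.norm
  linarith

/-- Picard iteration for the rescaled unknown `exp (-2L (t - a)) • x(t)`. The weight makes the
iteration a contraction of ratio `1/2` on the whole interval, so no short intervals have to be
glued. -/
theorem exists_isSolution {n : ℕ} {f : ℝ → Euc n → Euc n} {a b L : ℝ} (hab : a ≤ b)
    (hL : 0 < L) (hf : ∀ τ y₁ y₂, ‖f τ y₁ - f τ y₂‖ ≤ L * ‖y₁ - y₂‖)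
    (hi : ∀ y : ℝ → Euc n, ContinuousOn y (Icc a b) →
      IntervalIntegrable (fun τ => f τ (y τ)) volume a b) (ξ : Euc n) :
    ∃ x, IsSolution f a b ξ x := by
  let w : C(Icc a b, Euc n) → ℝ → Euc n := fun y τ =>
    Real.exp (2 * L * (τ - a)) • IccExtend hab y τ
  have hw : ∀ y, Continuous (w y) := fun y =>
    (by fun_prop : Continuous fun τ => Real.exp (2 * L * (τ - a))).smul
      (y.continuous.Icc_extend' (h := hab))
  have hwi : ∀ y, IntervalIntegrable (fun τ => f τ (w y τ)) volume a b := fun y =>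
    hi _ (hw y).continuousOn
  have hsub : ∀ t ∈ Icc a b, uIcc a t ⊆ uIcc a b := fun t ht => by
    rw [uIcc_of_le ht.1, uIcc_of_le hab]; exact Icc_subset_Icc_right ht.2
  have hcont : ∀ y, ContinuousOn (fun t => ξ + ∫ τ in a..t, f τ (w y τ)) (Icc a b) := fun y => by
    have := intervalIntegral.continuousOn_primitive_interval' (hwi y) left_mem_uIcc
    rw [uIcc_of_le hab] at this
    exact continuousOn_const.add this
  let Φ : C(Icc a b, Euc n) → C(Icc a b, Euc n) := fun y =>
    ⟨fun t => Real.exp (-(2 * L * (t - a))) • (ξ + ∫ τ in a..(t : ℝ), f τ (w y τ)), by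
      exact (by fun_prop : Continuous fun t : Icc a b => Real.exp (-(2 * L * ((t : ℝ) - a)))).smul
        (continuousOn_iff_continuous_domRestrict.1 (hcont y))⟩
  have hΦ : ContractingWith (1 / 2) Φ := by
    refine ⟨by rw [← NNReal.coe_lt_coe]; norm_num, LipschitzWith.of_dist_le_mul fun y₁ y₂ => ?_⟩
    rw [ContinuousMap.dist_le (by positivity)]
    intro t
    have ht := t.2
    have hd : 0 ≤ dist y₁ y₂ := dist_nonneg
    have hInt : ‖∫ τ in a..(t : ℝ), (f τ (w y₁ τ) - f τ (w y₂ τ))‖ ≤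
        ∫ τ in a..(t : ℝ), L * dist y₁ y₂ * Real.exp (2 * L * (τ - a)) := by
      refine intervalIntegral.norm_integral_le_of_norm_le ht.1 (Eventually.of_forall
        fun τ hτ => ?_) (Continuous.intervalIntegrable (by fun_prop) _ _)
      refine (hf τ _ _).trans ?_
      have h1 : w y₁ τ - w y₂ τ = Real.exp (2 * L * (τ - a)) •
          (y₁ (projIcc a b hab τ) - y₂ (projIcc a b hab τ)) := by
        simp only [w, IccExtend, Function.comp, smul_sub]
      rw [h1, norm_smul, Real.norm_of_nonneg (Real.exp_nonneg _), ← dist_eq_norm]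
      have := ContinuousMap.dist_apply_le_dist (f := y₁) (g := y₂) (projIcc a b hab τ)
      have h3 := mul_le_mul_of_nonneg_left this (mul_nonneg hL.le (Real.exp_nonneg
        (2 * L * (τ - a))))
      linarith
    have hval : ∫ τ in a..(t : ℝ), L * dist y₁ y₂ * Real.exp (2 * L * (τ - a)) =
        dist y₁ y₂ / 2 * (Real.exp (2 * L * (t - a)) - 1) := by
      have : ∀ τ ∈ uIcc a (t : ℝ), HasDerivAt
          (fun τ => dist y₁ y₂ / 2 * Real.exp (2 * L * (τ - a)))
          (L * dist y₁ y₂ * Real.exp (2 * L * (τ - a))) τ := fun τ _ => by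
        have he : HasDerivAt (fun s => Real.exp (2 * L * (s - a)))
            (Real.exp (2 * L * (τ - a)) * (2 * L * 1)) τ :=
          (((hasDerivAt_id τ).sub_const a).const_mul (2 * L)).exp
        convert! he.const_mul (dist y₁ y₂ / 2) using 1
        ring
      rw [intervalIntegral.integral_eq_sub_of_hasDerivAt this
        (Continuous.intervalIntegrable (by fun_prop) _ _)]
      simp
      ring
    rw [hval, intervalIntegral.integral_sub ((hwi y₁).mono_set (hsub t ht))
      ((hwi y₂).mono_set (hsub t ht))] at hInt
    have : Φ y₁ t - Φ y₂ t = Real.exp (-(2 * L * (t - a))) •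
        ((∫ τ in a..(t : ℝ), f τ (w y₁ τ)) - ∫ τ in a..(t : ℝ), f τ (w y₂ τ)) := by
      simp only [Φ, ContinuousMap.coe_mk, ← smul_sub, add_sub_add_left_eq_sub]
    rw [dist_eq_norm, this, norm_smul, Real.norm_of_nonneg (Real.exp_nonneg _)]
    calc _ ≤ Real.exp (-(2 * L * (t - a))) *
          (dist y₁ y₂ / 2 * (Real.exp (2 * L * (t - a)) - 1)) := by gcongr
      _ = dist y₁ y₂ / 2 * (1 - Real.exp (-(2 * L * (t - a)))) := by
        rw [Real.exp_neg]; field_simp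
      _ ≤ dist y₁ y₂ / 2 * 1 := by
        gcongr; linarith [Real.exp_nonneg (-(2 * L * (t - a)))]
      _ = _ := by push_cast; ring
  have : Nonempty C(Icc a b, Euc n) := ⟨0⟩
  have hfix : Φ (hΦ.fixedPoint Φ) = hΦ.fixedPoint Φ := hΦ.fixedPoint_isFixedPt
  set y := hΦ.fixedPoint Φ
  refine ⟨w y, (hw y).continuousOn, hwi y, fun t ht => ?_⟩
  have h1 : y ⟨t, ht⟩ = Real.exp (-(2 * L * (t - a))) • (ξ + ∫ τ in a..t, f τ (w y τ)) := by
    conv_lhs => rw [← hfix]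
    rfl
  have h2 : w y t = Real.exp (2 * L * (t - a)) • y ⟨t, ht⟩ := by
    simp only [w, IccExtend_of_mem hab _ ht]
  rw [h2, h1, smul_smul, ← Real.exp_add]
  simp

/-! ### The energy identity -/

/-- Since `f` is merely integrable, `x` is only absolutely continuous; the identity is the product
rule for absolutely continuous functions, coordinate by coordinate. -/
theorem norm_sq_sub_norm_sq_eq_integral {n : ℕ} {f : ℝ → Euc n} {a b : ℝ} (hab : a ≤ b)
    (hf : IntervalIntegrable f volume a b) {ξ : Euc n} {x : ℝ → Euc n}
    (hx : ∀ t ∈ Icc a b, x t = ξ + ∫ τ in a..t, f τ) :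
    ‖x b‖ ^ 2 - ‖x a‖ ^ 2 = ∫ τ in a..b, 2 * inner ℝ (x τ) (f τ) := by
  have hfi : ∀ i, IntervalIntegrable (fun τ => f τ i) volume a b := fun i =>
    ⟨(EuclideanSpace.proj (𝕜 := ℝ) i).integrable_comp hf.1,
      (EuclideanSpace.proj (𝕜 := ℝ) i).integrable_comp hf.2⟩
  have hsub : ∀ t ∈ Icc a b, uIcc a t ⊆ uIcc a b := fun t ht => by
    rw [uIcc_of_le ht.1, uIcc_of_le hab]; exact Icc_subset_Icc_right ht.2
  have hxi : ∀ i, ∀ t ∈ Icc a b, x t i = ξ i + ∫ τ in a..t, f τ i := fun i t ht => by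
    have := (EuclideanSpace.proj (𝕜 := ℝ) i).intervalIntegral_comp_comm
      (hf.mono_set (hsub t ht))
    rw [hx t ht]
    simpa using this.symm
  have hac : ∀ i, AbsolutelyContinuousOnInterval (fun t => ∫ τ in a..t, f τ i) a b := fun i =>
    (hfi i).absolutelyContinuousOnInterval_intervalIntegral left_mem_uIcc
  have hacX : ∀ i, AbsolutelyContinuousOnInterval (fun t => ξ i + ∫ τ in a..t, f τ i) a b :=
    fun i => (LipschitzWith.const (ξ i)).lipschitzOnWith.absolutelyContinuousOnInterval.add (hac i)
  have hi : ∀ i, x b i * x b i - x a i * x a i = ∫ τ in a..b, 2 * (x τ i * f τ i) := fun i => by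
    have := (hacX i).integral_deriv_mul_eq_sub (hacX i)
    rw [hxi i b (right_mem_Icc.2 hab), hxi i a (left_mem_Icc.2 hab), ← this]
    refine intervalIntegral.integral_congr_ae ?_
    filter_upwards [(hfi i).ae_hasDerivAt_integral] with t ht ht'
    have ht2 := uIoc_subset_uIcc ht'
    have h1 := ((ht ht2 a left_mem_uIcc).const_add (ξ i)).deriv
    rw [uIcc_of_le hab] at ht2
    rw [h1, hxi i t ht2]
    ring
  have hxc : ∀ i, ContinuousOn (fun t => x t i) (uIcc a b) := fun i =>
    (hacX i).continuousOn.congr fun t ht => hxi i t (by rwa [uIcc_of_le hab] at ht)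
  have hInt : ∀ i ∈ Finset.univ, IntervalIntegrable (fun τ => 2 * (x τ i * f τ i)) volume a b :=
    fun i _ => ((hfi i).continuousOn_mul (hxc i)).const_mul 2
  have h2 : ∀ τ, 2 * inner ℝ (x τ) (f τ) = ∑ i, 2 * (x τ i * f τ i) := fun τ => by
    rw [← Finset.mul_sum, PiLp.inner_apply]
    simp [mul_comm]
  simp_rw [h2]
  rw [intervalIntegral.integral_finsetSum hInt, EuclideanSpace.norm_sq_eq,
    EuclideanSpace.norm_sq_eq, ← Finset.sum_sub_distrib]
  refine Finset.sum_congr rfl fun i _ => ?_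
  rw [← hi i]
  simp [sq]

/-! ### The pseudoinverse and its measurable dependence on the data -/

section Pinv

variable {n m : ℕ}

theorem pinv_mem (B : Euc m →L[ℝ] Euc n) (d : Euc n) :
    pinv B d ∈ (LinearMap.ker B.toLinearMap)ᗮ :=
  Subtype.property _

theorem apply_pinv (B : Euc m →L[ℝ] Euc n) (d : Euc n) :
    B (pinv B d) = (LinearMap.range B.toLinearMap).orthogonalProjectionOnto d := by
  have h := (LinearEquiv.ofBijective (coreMap B) (coreMap_bijective B)).apply_symm_apply
    ((LinearMap.range B.toLinearMap).orthogonalProjectionOnto d)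
  exact congrArg Subtype.val h

theorem apply_pinv_of_mem_range (B : Euc m →L[ℝ] Euc n) {d : Euc n} (hd : d ∈ range B) :
    B (pinv B d) = d := by
  rw [apply_pinv]
  exact Submodule.starProjection_eq_self_iff.2 hd

open ContinuousLinearMap in
theorem adjoint_apply_pinv (B : Euc m →L[ℝ] Euc n) (d : Euc n) :
    adjoint B (B (pinv B d)) = adjoint B d := by
  have h1 : d - B (pinv B d) ∈ (LinearMap.range B.toLinearMap)ᗮ := by
    rw [apply_pinv]
    exact Submodule.sub_starProjection_mem_orthogonal d
  rw [show (LinearMap.range B.toLinearMap)ᗮ = (adjoint B).ker from B.orthogonal_range,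
    LinearMap.mem_ker] at h1
  have h2 : adjoint B (d - B (pinv B d)) = 0 := h1
  rw [map_sub, sub_eq_zero] at h2
  exact h2.symm

open ContinuousLinearMap in
/-- The regularized normal operator `B* B + c`. -/
noncomputable def tikhonov (c : ℝ) (B : Euc m →L[ℝ] Euc n) : Euc m →L[ℝ] Euc m :=
  (adjoint B).comp B + c • (1 : Euc m →L[ℝ] Euc m)

open ContinuousLinearMap in
theorem tikhonov_apply (c : ℝ) (B : Euc m →L[ℝ] Euc n) (v : Euc m) :
    tikhonov c B v = adjoint B (B v) + c • v := rfl

theorem mul_norm_le_norm_tikhonov (c : ℝ) (B : Euc m →L[ℝ] Euc n) (v : Euc m) :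
    c * ‖v‖ ≤ ‖tikhonov c B v‖ := by
  rcases eq_or_ne v 0 with rfl | hv
  · simp
  have h1 : inner ℝ (tikhonov c B v) v = ‖B v‖ ^ 2 + c * ‖v‖ ^ 2 := by
    rw [tikhonov_apply, inner_add_left, ContinuousLinearMap.adjoint_inner_left,
      real_inner_self_eq_norm_sq, real_inner_smul_left, real_inner_self_eq_norm_sq]
  have h2 := real_inner_le_norm (tikhonov c B v) v
  have h3 : 0 < ‖v‖ := norm_pos_iff.2 hv
  refine le_of_mul_le_mul_right ?_ h3
  nlinarith [sq_nonneg ‖B v‖]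

theorem isUnit_tikhonov {c : ℝ} (hc : 0 < c) (B : Euc m →L[ℝ] Euc n) :
    IsUnit (tikhonov c B) := by
  rw [ContinuousLinearMap.isUnit_iff_isUnit_toLinearMap, LinearMap.isUnit_iff_ker_eq_bot,
    LinearMap.ker_eq_bot']
  intro v hv
  have h1 := mul_norm_le_norm_tikhonov c B v
  have h2 : tikhonov c B v = 0 := hv
  rw [h2, norm_zero] at h1
  exact norm_le_zero_iff.1 (nonpos_of_mul_nonpos_right h1 hc)

theorem tikhonov_inverse_apply {c : ℝ} (hc : 0 < c) (B : Euc m →L[ℝ] Euc n) (v : Euc m) :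
    tikhonov c B (Ring.inverse (tikhonov c B) v) = v :=
  DFunLike.congr_fun (Ring.mul_inverse_cancel _ (isUnit_tikhonov hc B)) v

open ContinuousLinearMap in
theorem continuous_tikhonov_inverse {X : Type*} [TopologicalSpace X] {c : ℝ} (hc : 0 < c)
    {B : X → Euc m →L[ℝ] Euc n} {d : X → Euc n} (hB : Continuous B) (hd : Continuous d) :
    Continuous fun p => Ring.inverse (tikhonov c (B p)) (adjoint (B p) (d p)) := by
  have ha : Continuous fun p => adjoint (B p) :=
    (adjoint (𝕜 := ℝ) (E := Euc m) (F := Euc n)).continuous.comp hB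
  have hM : Continuous fun p => tikhonov c (B p) := (ha.clm_comp hB).add continuous_const
  have hI : Continuous fun p => Ring.inverse (tikhonov c (B p)) := by
    refine continuous_iff_continuousAt.2 fun p => ?_
    have := NormedRing.inverse_continuousAt (isUnit_tikhonov hc (B p)).unit
    rw [IsUnit.unit_spec] at this
    exact ContinuousAt.comp (f := fun p => tikhonov c (B p)) this hM.continuousAt
  exact hI.clm_apply (ha.clm_apply hd)

open ContinuousLinearMap in
-- `pinv B d` lies in `(ker B)ᗮ = range (B* B)`, say `pinv B d = B* B r`; regularizing by `c` then
-- moves the solution of the normal equation by at most `2c‖r‖`.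
theorem tendsto_tikhonov_pinv (B : Euc m →L[ℝ] Euc n) (d : Euc n) :
    Tendsto (fun k : ℕ => Ring.inverse (tikhonov (1 / ((k : ℝ) + 1)) B) (adjoint B d))
      atTop (𝓝 (pinv B d)) := by
  obtain ⟨r, hr⟩ : ∃ r, adjoint B (B r) = pinv B d := by
    have h := pinv_mem B d
    rw [LinearMap.orthogonal_ker, ← LinearMap.range_adjoint_comp_self] at h
    obtain ⟨r, hr⟩ := h
    exact ⟨r, hr⟩
  rw [tendsto_iff_norm_sub_tendsto_zero]
  refine squeeze_zero (fun _ => norm_nonneg _) (fun k => ?_)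
    (g := fun k : ℕ => 1 / ((k : ℝ) + 1) * (2 * ‖r‖)) ?_
  · set c : ℝ := 1 / ((k : ℝ) + 1)
    have hc : 0 < c := Nat.one_div_pos_of_nat
    set w := Ring.inverse (tikhonov c B) (adjoint B d)
    have hw : tikhonov c B w = adjoint B d := tikhonov_inverse_apply hc B _
    -- The corrector `c • r` cancels the first-order residual; the remaining order `c²` beats the
    -- `1/c` bound on the inverse.
    have h1 : tikhonov c B (w - pinv B d + c • r) = (c * c) • r := by
      rw [map_add, map_sub, hw, map_smul, tikhonov_apply, tikhonov_apply, hr, adjoint_apply_pinv,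
        smul_add, smul_smul]
      abel
    have h2 := mul_norm_le_norm_tikhonov c B (w - pinv B d + c • r)
    rw [h1, norm_smul, Real.norm_of_nonneg (mul_nonneg hc.le hc.le), mul_assoc] at h2
    have h3 := le_of_mul_le_mul_left h2 hc
    calc ‖w - pinv B d‖ = ‖(w - pinv B d + c • r) - c • r‖ := by rw [add_sub_cancel_right]
      _ ≤ ‖w - pinv B d + c • r‖ + ‖c • r‖ := norm_sub_le _ _
      _ ≤ c * ‖r‖ + c * ‖r‖ := by
        rw [norm_smul, Real.norm_of_nonneg hc.le]; gcongr
      _ = c * (2 * ‖r‖) := by ring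
  · simpa using tendsto_one_div_add_atTop_nhds_zero_nat.mul_const (2 * ‖r‖)

/-- The pseudoinverse jumps where the rank of `B` changes, but it is a pointwise limit of the
continuous Tikhonov regularizations. -/
theorem measurable_pinv {X : Type*} [TopologicalSpace X] [MeasurableSpace X] [BorelSpace X]
    {B : X → Euc m →L[ℝ] Euc n} {d : X → Euc n} (hB : Continuous B) (hd : Continuous d) :
    Measurable fun p => pinv (B p) (d p) :=
  measurable_of_tendsto_metrizable
    (fun _ => (continuous_tikhonov_inverse Nat.one_div_pos_of_nat hB hd).measurable)
    (tendsto_pi_nhds.2 fun p => tendsto_tikhonov_pinv (B p) (d p))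

end Pinv

/-! ### The Jacobians -/

section Jacobian

variable {n m : ℕ} {F : Euc n × Euc m → Euc n} {LF : ℝ}

theorem hasFDerivAt_of_contDiff (hF : ContDiff ℝ 1 F) (p : Euc n × Euc m) :
    HasFDerivAt F (fderiv ℝ F p) p :=
  (hF.differentiable (by norm_num) p).hasFDerivAt

theorem jacA_eq (hF : ContDiff ℝ 1 F) (x : Euc n) (u : Euc m) :
    jacA F x u = (fderiv ℝ F (x, u)).comp (ContinuousLinearMap.inl ℝ (Euc n) (Euc m)) :=
  ((hasFDerivAt_of_contDiff hF (x, u)).comp x (hasFDerivAt_prodMk_left x u)).fderiv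

theorem jacB_eq (hF : ContDiff ℝ 1 F) (x : Euc n) (u : Euc m) :
    jacB F x u = (fderiv ℝ F (x, u)).comp (ContinuousLinearMap.inr ℝ (Euc n) (Euc m)) :=
  ((hasFDerivAt_of_contDiff hF (x, u)).comp u (hasFDerivAt_prodMk_right x u)).fderiv

theorem fderiv_apply_eq (hF : ContDiff ℝ 1 F) (x v : Euc n) (u w : Euc m) :
    fderiv ℝ F (x, u) (v, w) = jacA F x u v + jacB F x u w := by
  rw [jacA_eq hF, jacB_eq hF]
  simp [← map_add]

theorem continuous_jacA (hF : ContDiff ℝ 1 F) :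
    Continuous fun p : Euc n × Euc m => jacA F p.1 p.2 := by
  simp_rw [jacA_eq hF]
  exact (hF.continuous_fderiv (by norm_num)).clm_comp continuous_const

theorem continuous_jacB (hF : ContDiff ℝ 1 F) :
    Continuous fun p : Euc n × Euc m => jacB F p.1 p.2 := by
  simp_rw [jacB_eq hF]
  exact (hF.continuous_fderiv (by norm_num)).clm_comp continuous_const

theorem continuous_drift (hF : ContDiff ℝ 1 F) :
    Continuous fun p : Euc n × Euc m => drift F p.1 p.2 :=
  (hF.continuous.sub ((continuous_jacA hF).clm_apply continuous_fst)).sub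
    ((continuous_jacB hF).clm_apply continuous_snd)

theorem norm_jacA_apply_le (hLF : 0 < LF)
    (hFLip : ∀ x₁ x₂ u₁ u₂, ‖F (x₁, u₁) - F (x₂, u₂)‖ ≤ LF * (‖x₁ - x₂‖ + ‖u₁ - u₂‖))
    (x v : Euc n) (u : Euc m) : ‖jacA F x u v‖ ≤ LF * ‖v‖ := by
  refine (jacA F x u).le_of_opNorm_le (norm_fderiv_le_of_lip' ℝ hLF.le ?_) v
  exact Eventually.of_forall fun y => by simpa using hFLip y x u u

theorem norm_jacB_apply_le (hLF : 0 < LF)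
    (hFLip : ∀ x₁ x₂ u₁ u₂, ‖F (x₁, u₁) - F (x₂, u₂)‖ ≤ LF * (‖x₁ - x₂‖ + ‖u₁ - u₂‖))
    (x : Euc n) (u v : Euc m) : ‖jacB F x u v‖ ≤ LF * ‖v‖ := by
  refine (jacB F x u).le_of_opNorm_le (norm_fderiv_le_of_lip' ℝ hLF.le ?_) v
  exact Eventually.of_forall fun y => by simpa using hFLip x x y u

end Jacobian

/-! ### Trajectories -/

section Trajectory

variable {n m : ℕ} {F : Euc n × Euc m → Euc n} {LF T : ℝ} {x₀ : Euc n} {u : ℝ → Euc m}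

theorem exists_isTrajectory (hLF : 0 < LF)
    (hFLip : ∀ x₁ x₂ u₁ u₂, ‖F (x₁, u₁) - F (x₂, u₂)‖ ≤ LF * (‖x₁ - x₂‖ + ‖u₁ - u₂‖))
    (hF : Continuous F) (hT : 0 ≤ T) (hu : AdmissibleInput 0 T u) (x₀ : Euc n) :
    ∃ x, IsTrajectory F T x₀ u x :=
  exists_isSolution hT hLF (fun τ y₁ y₂ => by simpa using hFLip y₁ y₂ (u τ) (u τ))
    (fun _ hy => (memLp_top_comp hF hy hu).intervalIntegrable_of_top
      (left_mem_Icc.2 hT) (right_mem_Icc.2 hT)) x₀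

theorem isTrajectory_stateTraj (hLF : 0 < LF)
    (hFLip : ∀ x₁ x₂ u₁ u₂, ‖F (x₁, u₁) - F (x₂, u₂)‖ ≤ LF * (‖x₁ - x₂‖ + ‖u₁ - u₂‖))
    (hF : Continuous F) (hT : 0 ≤ T) (hu : AdmissibleInput 0 T u) (x₀ : Euc n) :
    IsTrajectory F T x₀ u (stateTraj F T x₀ u) := by
  have h := exists_isTrajectory hLF hFLip hF hT hu x₀
  rw [stateTraj, dif_pos h]
  exact h.choose_spec

theorem IsTrajectory.norm_sub_le (hLF : 0 < LF)
    (hFLip : ∀ x₁ x₂ u₁ u₂, ‖F (x₁, u₁) - F (x₂, u₂)‖ ≤ LF * (‖x₁ - x₂‖ + ‖u₁ - u₂‖))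
    (hT : 0 ≤ T) {v : ℝ → Euc m} {x y : ℝ → Euc n} (hu : AdmissibleInput 0 T u)
    (hv : AdmissibleInput 0 T v) (hx : IsTrajectory F T x₀ u x) (hy : IsTrajectory F T x₀ v y) :
    ∀ t ∈ Icc 0 T, ‖y t - x t‖ ≤ (LF * ∫ τ in (0 : ℝ)..T, ‖v τ - u τ‖) * Real.exp (LF * T) := by
  intro t ht
  have hInt : IntervalIntegrable (fun τ => LF • (v τ - u τ)) volume 0 T :=
    ((hv.sub hu).intervalIntegrable_of_top (left_mem_Icc.2 hT) (right_mem_Icc.2 hT)).smul LF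
  have key := norm_le_of_norm_deriv_le hLF.le (r := fun t => y t - x t)
    (hy.continuousOn.sub hx.continuousOn)
    (k := fun τ => F (y τ, v τ) - F (x τ, u τ)) hInt (fun t ht => by
      have hsub : uIcc 0 t ⊆ uIcc 0 T := by
        rw [uIcc_of_le ht.1, uIcc_of_le hT]; exact Icc_subset_Icc_right ht.2
      rw [intervalIntegral.integral_sub (hy.integrable.mono_set hsub)
        (hx.integrable.mono_set hsub), hy.eq_integral t ht, hx.eq_integral t ht]
      abel)
    (Eventually.of_forall fun τ => by
      rw [norm_smul, Real.norm_of_nonneg hLF.le, ← mul_add]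
      exact hFLip _ _ _ _) t ht
  simp only [norm_smul, Real.norm_of_nonneg hLF.le, intervalIntegral.integral_const_mul] at key
  have hnn : 0 ≤ LF * ∫ τ in (0 : ℝ)..T, ‖v τ - u τ‖ :=
    mul_nonneg hLF.le (intervalIntegral.integral_nonneg hT fun _ _ => norm_nonneg _)
  refine key.trans ?_
  gcongr
  linarith [ht.2]

theorem IsTrajectory.unique (hLF : 0 < LF)
    (hFLip : ∀ x₁ x₂ u₁ u₂, ‖F (x₁, u₁) - F (x₂, u₂)‖ ≤ LF * (‖x₁ - x₂‖ + ‖u₁ - u₂‖))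
    (hT : 0 ≤ T) {x y : ℝ → Euc n} (hu : AdmissibleInput 0 T u)
    (hx : IsTrajectory F T x₀ u x) (hy : IsTrajectory F T x₀ u y) :
    ∀ t ∈ Icc 0 T, y t = x t := by
  intro t ht
  have := IsTrajectory.norm_sub_le hLF hFLip hT hu hu hx hy t ht
  simpa [sub_eq_zero] using this

end Trajectory

/-! ### The derivative of the cost -/

/-- Increments are dominated only relative to `η = 0`, and differentiability is asked only there:
this is all that the perturbation estimates for trajectories provide. -/
theorem hasDerivAt_integral_of_norm_sub_le {α : Type*} [MeasurableSpace α] {μ : Measure α}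
    {G : ℝ → α → ℝ} {G' bound : α → ℝ}
    (hG : ∀ η, AEStronglyMeasurable (G η) μ) (hG0 : Integrable (G 0) μ)
    (hG' : AEStronglyMeasurable G' μ)
    (hlip : ∀ᵐ a ∂μ, ∀ η ∈ Metric.ball (0 : ℝ) 1, ‖G η a - G 0 a‖ ≤ bound a * ‖η‖)
    (hb : Integrable bound μ) (hd : ∀ᵐ a ∂μ, HasDerivAt (G · a) (G' a) 0) :
    HasDerivAt (fun η => ∫ a, G η a ∂μ) (∫ a, G' a ∂μ) 0 := by
  set L : ℝ →L[ℝ] ℝ →L[ℝ] ℝ := ContinuousLinearMap.smulRightL ℝ ℝ ℝ 1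
  have hd' : ∀ᵐ a ∂μ, HasFDerivAt (G · a) (L (G' a)) 0 := hd.mono fun a ha => ha.hasFDerivAt
  have hm : AEStronglyMeasurable (L ∘ G') μ := L.continuous.comp_aestronglyMeasurable hG'
  obtain ⟨hi, key⟩ := hasFDerivAt_integral_of_dominated_loc_of_lip'
    (Metric.ball_mem_nhds (0 : ℝ) one_pos) (fun η _ => hG η) hG0 hm
    (by simpa using hlip) hb hd'
  have hi' : Integrable G' μ := by
    rw [← integrable_norm_iff hm] at hi
    have hi2 : Integrable (fun a => ‖G' a‖) μ := by
      simpa [L, (· ∘ ·)] using! hi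
    exact (integrable_norm_iff hG').1 hi2
  rw [hasDerivAt_iff_hasFDerivAt]
  simpa only [(· ∘ ·), ContinuousLinearMap.integral_comp_comm _ hi'] using! key

theorem exists_lipschitz_closedBall {k : ℕ} {G : Euc k → ℝ} (hG : ContDiff ℝ 1 G) (ρ : ℝ) :
    ∃ K, 0 ≤ K ∧ ∀ x y, ‖x‖ ≤ ρ → ‖y‖ ≤ ρ → ‖G x - G y‖ ≤ K * ‖x - y‖ := by
  obtain ⟨K, hK⟩ := (hG.contDiffOn (s := Metric.closedBall (0 : Euc k) ρ)).exists_lipschitzOnWith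
    (by norm_num) (convex_closedBall _ _) (isCompact_closedBall _ _)
  exact ⟨K, K.2, fun x y hx hy => hK.norm_sub_le (mem_closedBall_zero_iff.2 hx)
    (mem_closedBall_zero_iff.2 hy)⟩

section Derivative

variable {n m : ℕ} {F : Euc n × Euc m → Euc n} {LF T : ℝ} {x₀ : Euc n} {u h : ℝ → Euc m}
  {x z : ℝ → Euc n}

theorem AdmissibleInput.add_smul (hu : AdmissibleInput 0 T u) (hh : AdmissibleInput 0 T h)
    (η : ℝ) : AdmissibleInput 0 T (u + η • h) :=
  MemLp.add hu (MemLp.const_smul hh η)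

theorem exists_norm_stateTraj_sub_le (hF : ContDiff ℝ 1 F) (hLF : 0 < LF)
    (hFLip : ∀ x₁ x₂ u₁ u₂, ‖F (x₁, u₁) - F (x₂, u₂)‖ ≤ LF * (‖x₁ - x₂‖ + ‖u₁ - u₂‖))
    (hT : 0 ≤ T) (hu : AdmissibleInput 0 T u) (hx : IsTrajectory F T x₀ u x)
    (hh : AdmissibleInput 0 T h) :
    ∃ C, 0 ≤ C ∧ ∀ η : ℝ, ∀ t ∈ Icc 0 T, ‖stateTraj F T x₀ (u + η • h) t - x t‖ ≤ C * ‖η‖ := by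
  have hnn : 0 ≤ ∫ τ in (0 : ℝ)..T, ‖h τ‖ :=
    intervalIntegral.integral_nonneg hT fun _ _ => norm_nonneg _
  refine ⟨LF * (∫ τ in (0 : ℝ)..T, ‖h τ‖) * Real.exp (LF * T), by positivity, fun η t ht => ?_⟩
  refine (IsTrajectory.norm_sub_le hLF hFLip hT hu (hu.add_smul hh η) hx
    (isTrajectory_stateTraj hLF hFLip hF.continuous hT (hu.add_smul hh η) x₀) t ht).trans
    (le_of_eq ?_)
  simp only [Pi.add_apply, Pi.smul_apply, add_sub_cancel_left, norm_smul,
    intervalIntegral.integral_const_mul]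
  ring

/-- The error `X η - x - η z` solves the linearized equation forced by the first-order Taylor
remainder `o η` of `F`. By Gronwall it suffices that `∫ ‖o η‖` is `o(η)`, which follows from
dominated differentiation. -/
theorem hasDerivAt_stateTraj (hF : ContDiff ℝ 1 F) (hLF : 0 < LF)
    (hFLip : ∀ x₁ x₂ u₁ u₂, ‖F (x₁, u₁) - F (x₂, u₂)‖ ≤ LF * (‖x₁ - x₂‖ + ‖u₁ - u₂‖))
    (hT : 0 ≤ T) (hu : AdmissibleInput 0 T u) (hx : IsTrajectory F T x₀ u x)
    (hh : AdmissibleInput 0 T h)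
    (hz : IsSolution (fun τ y => jacA F (x τ) (u τ) y + jacB F (x τ) (u τ) (h τ)) 0 T 0 z) :
    ∀ t ∈ Icc 0 T, HasDerivAt (fun η : ℝ => stateTraj F T x₀ (u + η • h) t) (z t) 0 := by
  set X : ℝ → ℝ → Euc n := fun η => stateTraj F T x₀ (u + η • h) with hXdef
  have huη := hu.add_smul hh
  have hX : ∀ η, IsTrajectory F T x₀ (u + η • h) (X η) := fun η =>
    isTrajectory_stateTraj hLF hFLip hF.continuous hT (huη η) x₀
  have hX0 : ∀ t ∈ Icc 0 T, X 0 t = x t :=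
    IsTrajectory.unique hLF hFLip hT hu hx (by simpa using hX 0)
  obtain ⟨C, hC0, hC⟩ := exists_norm_stateTraj_sub_le hF hLF hFLip hT hu hx hh
  set o : ℝ → ℝ → Euc n := fun η τ => F (X η τ, u τ + η • h τ) - F (x τ, u τ) -
    fderiv ℝ F (x τ, u τ) (X η τ - x τ, η • h τ) with hodef
  have hoeq : ∀ η τ, o η τ = F (X η τ, u τ + η • h τ) - F (x τ, u τ) -
      (jacA F (x τ) (u τ) (X η τ - x τ) + η • jacB F (x τ) (u τ) (h τ)) := fun η τ => by
    simp only [hodef, fderiv_apply_eq hF, map_smul]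
  have hhi : Integrable (fun τ => ‖h τ‖) (volume.restrict (Icc 0 T)) :=
    (hh.integrable (by simp)).norm
  have hmA : AEStronglyMeasurable (fun τ => jacA F (x τ) (u τ)) (volume.restrict (Icc 0 T)) :=
    (memLp_top_comp (continuous_jacA hF) hx.continuousOn hu).1
  have hmB : AEStronglyMeasurable (fun τ => jacB F (x τ) (u τ)) (volume.restrict (Icc 0 T)) :=
    (memLp_top_comp (continuous_jacB hF) hx.continuousOn hu).1
  have hap : ∀ {k : ℕ}, Continuous fun p : (Euc k →L[ℝ] Euc n) × Euc k => p.1 p.2 :=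
    fun {k} => isBoundedBilinearMap_apply.continuous
  have hom : ∀ η, AEStronglyMeasurable (o η) (volume.restrict (Icc 0 T)) := fun η => by
    simp_rw [funext (hoeq η)]
    refine ((memLp_top_comp hF.continuous (hX η).continuousOn (huη η)).1.sub
      (memLp_top_comp hF.continuous hx.continuousOn hu).1).sub (AEStronglyMeasurable.add ?_
        (AEStronglyMeasurable.const_smul ?_ η))
    · exact hap.comp_aestronglyMeasurable (hmA.prodMk
        (((hX η).continuousOn.sub hx.continuousOn).aestronglyMeasurable measurableSet_Icc))
    · exact hap.comp_aestronglyMeasurable (hmB.prodMk hh.1)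
  -- The increment of `F` and its linear part each contribute `LF (C + ‖h τ‖) ‖η‖`; this is the
  -- domination used for `∫ ‖o η‖`.
  have hob : ∀ η, ∀ τ ∈ Icc 0 T, ‖o η τ‖ ≤ 2 * LF * (C + ‖h τ‖) * ‖η‖ := fun η τ hτ => by
    rw [hoeq]
    have h1 := hFLip (X η τ) (x τ) (u τ + η • h τ) (u τ)
    have h2 := norm_jacA_apply_le hLF hFLip (x τ) (X η τ - x τ) (u τ)
    have h3 := norm_jacB_apply_le hLF hFLip (x τ) (u τ) (h τ)
    have h4 := hC η τ hτ
    rw [add_sub_cancel_left, norm_smul] at h1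
    have h5 : ‖η • jacB F (x τ) (u τ) (h τ)‖ ≤ ‖η‖ * (LF * ‖h τ‖) := by
      rw [norm_smul]; gcongr
    have h6 : LF * ‖X η τ - x τ‖ ≤ LF * (C * ‖η‖) := by gcongr
    have h7 := norm_sub_le (F (X η τ, u τ + η • h τ) - F (x τ, u τ))
      (jacA F (x τ) (u τ) (X η τ - x τ) + η • jacB F (x τ) (u τ) (h τ))
    have h8 := norm_add_le (jacA F (x τ) (u τ) (X η τ - x τ)) (η • jacB F (x τ) (u τ) (h τ))
    linarith
  have ho0 : ∀ τ ∈ Icc 0 T, o 0 τ = 0 := fun τ hτ => by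
    have := hob 0 τ hτ
    simpa using this
  have hod : ∀ τ ∈ Icc 0 T, HasDerivAt (fun η => ‖o η τ‖) 0 0 := fun τ hτ => by
    rw [hasDerivAt_iff_isLittleO_nhds_zero]
    simp only [zero_add, ho0 τ hτ, norm_zero, sub_zero, smul_zero]
    have hb : (fun η : ℝ => (X η τ - x τ, η • h τ)) =O[𝓝 0] fun η : ℝ => η := by
      refine Asymptotics.IsBigO.of_bound (C + ‖h τ‖) (Eventually.of_forall fun η => ?_)
      rw [Prod.norm_mk]
      have := hC η τ hτ
      refine max_le ?_ ?_
      · exact this.trans (by gcongr; linarith [norm_nonneg (h τ)])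
      · rw [norm_smul, mul_comm]; gcongr; linarith
    have ht : Tendsto (fun η : ℝ => ((X η τ - x τ, η • h τ) : Euc n × Euc m)) (𝓝 0) (𝓝 0) :=
      hb.trans_tendsto tendsto_id
    have hl := (hasFDerivAt_iff_isLittleO_nhds_zero.1
      (hasFDerivAt_of_contDiff hF (x τ, u τ))).comp_tendsto ht
    refine (hl.trans_isBigO hb).norm_left.congr_left fun η => ?_
    simp [hodef, Function.comp]
  have hbi : Integrable (fun τ => 2 * LF * (C + ‖h τ‖)) (volume.restrict (Icc 0 T)) :=
    ((integrable_const C).add hhi).const_mul (2 * LF)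
  have hoi : ∀ η, Integrable (o η) (volume.restrict (Icc 0 T)) := fun η =>
    (hbi.mul_const ‖η‖).mono' (hom η) ((ae_restrict_mem measurableSet_Icc).mono fun τ hτ =>
      hob η τ hτ)
  have hΦ : HasDerivAt (fun η => ∫ τ in Icc 0 T, ‖o η τ‖) (∫ _ in Icc 0 T, (0 : ℝ)) 0 :=
    hasDerivAt_integral_of_norm_sub_le (fun η => (hom η).norm) (hoi 0).norm
      aestronglyMeasurable_const ((ae_restrict_mem measurableSet_Icc).mono fun τ hτ η _ => by
        simpa [ho0 τ hτ] using hob η τ hτ) hbi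
      ((ae_restrict_mem measurableSet_Icc).mono hod)
  have hΦ0 : ∫ τ in Icc 0 T, ‖o 0 τ‖ = 0 := by
    rw [setIntegral_congr_fun (g := fun _ => (0 : ℝ)) measurableSet_Icc fun τ hτ => by
      simp [ho0 τ hτ]]
    simp
  rw [hasDerivAt_iff_isLittleO_nhds_zero] at hΦ
  simp only [zero_add, hΦ0, integral_zero, smul_zero, sub_zero] at hΦ
  have hr : ∀ η, ∀ t ∈ Icc 0 T, ‖X η t - x t - η • z t‖ ≤
      (∫ τ in Icc 0 T, ‖o η τ‖) * Real.exp (LF * (t - 0)) := fun η t ht => by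
    have hoI : IntervalIntegrable (o η) volume 0 T := by
      rw [intervalIntegrable_iff_integrableOn_Icc_of_le hT]
      exact hoi η
    have := norm_le_of_norm_deriv_le hLF.le (r := fun t => X η t - x t - η • z t)
      (((hX η).continuousOn.sub hx.continuousOn).sub (hz.continuousOn.const_smul η))
      (k := fun τ => F (X η τ, u τ + η • h τ) - F (x τ, u τ) -
        η • (jacA F (x τ) (u τ) (z τ) + jacB F (x τ) (u τ) (h τ))) hoI (fun t ht => by
        have hsub : uIcc 0 t ⊆ uIcc 0 T := by
          rw [uIcc_of_le ht.1, uIcc_of_le hT]; exact Icc_subset_Icc_right ht.2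
        have i1 := (hX η).integrable.mono_set hsub
        have i2 := hx.integrable.mono_set hsub
        have i3 := hz.integrable.mono_set hsub
        have e1 : ∫ τ in (0 : ℝ)..t, (F (X η τ, u τ + η • h τ) - F (x τ, u τ) -
            η • (jacA F (x τ) (u τ) (z τ) + jacB F (x τ) (u τ) (h τ))) =
            ((∫ τ in (0 : ℝ)..t, F (X η τ, (u + η • h) τ)) - ∫ τ in (0 : ℝ)..t, F (x τ, u τ)) -
            η • ∫ τ in (0 : ℝ)..t, (jacA F (x τ) (u τ) (z τ) + jacB F (x τ) (u τ) (h τ)) := by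
          rw [← intervalIntegral.integral_smul, ← intervalIntegral.integral_sub i1 i2]
          exact intervalIntegral.integral_sub (i1.sub i2) (i3.smul η)
        rw [e1, (hX η).eq_integral t ht, hx.eq_integral t ht, hz.eq_integral t ht]
        simp)
      (Eventually.of_forall fun τ => by
        have h1 : F (X η τ, u τ + η • h τ) - F (x τ, u τ) -
            η • (jacA F (x τ) (u τ) (z τ) + jacB F (x τ) (u τ) (h τ)) =
            jacA F (x τ) (u τ) (X η τ - x τ - η • z τ) + o η τ := by
          rw [hoeq, map_sub _ (X η τ - x τ), map_smul, smul_add]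
          abel
        rw [h1]
        exact (norm_add_le _ _).trans (by
          gcongr; exact norm_jacA_apply_le hLF hFLip _ _ _)) t ht
    rwa [intervalIntegral.integral_of_le hT, ← integral_Icc_eq_integral_Ioc] at this
  intro t ht
  rw [hasDerivAt_iff_isLittleO_nhds_zero]
  simp only [zero_add]
  refine Asymptotics.IsBigO.trans_isLittleO (Asymptotics.IsBigO.of_bound
    (Real.exp (LF * (t - 0))) (Eventually.of_forall fun η => ?_)) hΦ
  have h1 := hr η t ht
  rw [← hX0 t ht, mul_comm] at h1
  exact h1.trans (mul_le_mul_of_nonneg_left (le_abs_self _) (Real.exp_nonneg _))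

theorem hasDerivAt_cost (hF : ContDiff ℝ 1 F) (hLF : 0 < LF)
    (hFLip : ∀ x₁ x₂ u₁ u₂, ‖F (x₁, u₁) - F (x₂, u₂)‖ ≤ LF * (‖x₁ - x₂‖ + ‖u₁ - u₂‖))
    {Q : Euc n → ℝ} {R : Euc m → ℝ} {V : Euc n → ℝ} (hQ : ContDiff ℝ 1 Q)
    (hR : ContDiff ℝ 1 R) (hV : ContDiff ℝ 1 V)
    (hT : 0 ≤ T) (hu : AdmissibleInput 0 T u) (hx : IsTrajectory F T x₀ u x)
    (hh : AdmissibleInput 0 T h)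
    (hz : IsSolution (fun τ y => jacA F (x τ) (u τ) y + jacB F (x τ) (u τ) (h τ)) 0 T 0 z) :
    HasDerivAt (fun η : ℝ => cost F Q R V T x₀ (u + η • h))
      ((∫ t in (0 : ℝ)..T, (fderiv ℝ Q (x t) (z t) + fderiv ℝ R (u t) (h t)))
        + fderiv ℝ V (x T) (z T)) 0 := by
  have hXd := hasDerivAt_stateTraj hF hLF hFLip hT hu hx hh hz
  obtain ⟨C, hC0, hC⟩ := exists_norm_stateTraj_sub_le hF hLF hFLip hT hu hx hh
  set X : ℝ → ℝ → Euc n := fun η => stateTraj F T x₀ (u + η • h) with hXdef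
  have huη := hu.add_smul hh
  have hX : ∀ η, IsTrajectory F T x₀ (u + η • h) (X η) := fun η =>
    isTrajectory_stateTraj hLF hFLip hF.continuous hT (huη η) x₀
  have hX0 : ∀ t ∈ Icc 0 T, X 0 t = x t :=
    IsTrajectory.unique hLF hFLip hT hu hx (by simpa using hX 0)
  have hQR : Continuous fun p : Euc n × Euc m => Q p.1 + R p.2 :=
    (hQ.continuous.comp continuous_fst).add (hR.continuous.comp continuous_snd)
  obtain ⟨D, hD⟩ := isCompact_Icc.exists_bound_of_continuousOn hx.continuousOn
  obtain ⟨M, hM0, hM⟩ := hu.exists_bound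
  obtain ⟨N, hN0, hN⟩ := hh.exists_bound
  -- The costs are only locally Lipschitz; for `‖η‖ ≤ 1` the perturbed states stay in radius `D + C`
  -- and, almost everywhere, the perturbed inputs in radius `M + N`.
  obtain ⟨KQ, hKQ0, hKQ⟩ := exists_lipschitz_closedBall hQ (D + C)
  obtain ⟨KR, hKR0, hKR⟩ := exists_lipschitz_closedBall hR (M + N)
  have hap : ∀ {k : ℕ}, Continuous fun p : (Euc k →L[ℝ] ℝ) × Euc k => p.1 p.2 :=
    fun {k} => isBoundedBilinearMap_apply.continuous
  have hQd : ∀ t ∈ Icc 0 T, HasDerivAt (fun η => Q (X η t)) (fderiv ℝ Q (x t) (z t)) 0 :=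
    fun t ht => by
    have h1 : HasFDerivAt Q (fderiv ℝ Q (x t)) (X 0 t) := by
      rw [hX0 t ht]
      exact (hQ.differentiable (by norm_num) _).hasFDerivAt
    exact h1.comp_hasDerivAt (0 : ℝ) (hXd t ht)
  have hVd : HasDerivAt (fun η => V (X η T)) (fderiv ℝ V (x T) (z T)) 0 := by
    have hTm : T ∈ Icc 0 T := right_mem_Icc.2 hT
    have h1 : HasFDerivAt V (fderiv ℝ V (x T)) (X 0 T) := by
      rw [hX0 T hTm]
      exact (hV.differentiable (by norm_num) _).hasFDerivAt
    exact h1.comp_hasDerivAt (0 : ℝ) (hXd T hTm)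
  have hRd : ∀ t, HasDerivAt (fun η : ℝ => R ((u + η • h) t)) (fderiv ℝ R (u t) (h t)) 0 :=
    fun t => by
    have h1 : HasFDerivAt R (fderiv ℝ R (u t)) (u t + (0 : ℝ) • h t) := by
      rw [zero_smul, add_zero]
      exact (hR.differentiable (by norm_num) _).hasFDerivAt
    have h2 : HasDerivAt (fun η : ℝ => u t + η • h t) (h t) 0 := by
      simpa using ((hasDerivAt_id (0 : ℝ)).smul_const (h t)).const_add (u t)
    exact h1.comp_hasDerivAt (0 : ℝ) h2
  have hmain : HasDerivAt (fun η => ∫ t in Icc 0 T, (Q (X η t) + R ((u + η • h) t)))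
      (∫ t in Icc 0 T, (fderiv ℝ Q (x t) (z t) + fderiv ℝ R (u t) (h t))) 0 := by
    refine hasDerivAt_integral_of_norm_sub_le (bound := fun _ => KQ * C + KR * N)
      (G := fun η t => Q (X η t) + R ((u + η • h) t))
      (fun η => (memLp_top_comp hQR (hX η).continuousOn (huη η)).1)
      ((memLp_top_comp hQR (hX 0).continuousOn (huη 0)).integrable (by simp)) ?_ ?_
      (integrable_const _) ?_
    · refine AEStronglyMeasurable.add ?_ ?_
      · have h1 : ContinuousOn (fun t => fderiv ℝ Q (x t)) (Icc 0 T) :=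
          (hQ.continuous_fderiv (by norm_num)).comp_continuousOn hx.continuousOn
        exact (h1.clm_apply hz.continuousOn).aestronglyMeasurable measurableSet_Icc
      · exact hap.comp_aestronglyMeasurable
          (((hR.continuous_fderiv (by norm_num)).comp_aestronglyMeasurable hu.1).prodMk hh.1)
    · filter_upwards [ae_restrict_mem measurableSet_Icc, hM, hN] with t ht h1 h2 η hη
      have hη1 : ‖η‖ ≤ 1 := (mem_ball_zero_iff.1 hη).le
      have h3 : ‖X η t - x t‖ ≤ C * ‖η‖ := hC η t ht
      have h4 : ‖X η t‖ ≤ D + C := by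
        have := norm_add_le (x t) (X η t - x t)
        rw [add_sub_cancel] at this
        nlinarith [hD t ht]
      have h5 : ‖η • h t‖ ≤ N * ‖η‖ := by
        rw [norm_smul, mul_comm]; gcongr
      have h6 : ‖u t + η • h t‖ ≤ M + N := by
        have := norm_add_le (u t) (η • h t)
        nlinarith
      have h7 := hKQ (X η t) (x t) h4 (by linarith [hD t ht])
      have h8 := hKR (u t + η • h t) (u t) h6 (by linarith)
      rw [add_sub_cancel_left] at h8
      have h9 : KQ * ‖X η t - x t‖ ≤ KQ * (C * ‖η‖) := by gcongr
      have h10 : KR * ‖η • h t‖ ≤ KR * (N * ‖η‖) := by gcongr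
      have h11 : Q (X η t) + R ((u + η • h) t) - (Q (X 0 t) + R ((u + (0 : ℝ) • h) t)) =
          (Q (X η t) - Q (x t)) + (R (u t + η • h t) - R (u t)) := by
        rw [hX0 t ht, zero_smul, add_zero]
        simp only [Pi.add_apply, Pi.smul_apply]
        ring
      rw [h11]
      refine (norm_add_le _ _).trans ?_
      linarith
    · filter_upwards [ae_restrict_mem measurableSet_Icc] with t ht
      exact (hQd t ht).add (hRd t)
  have hcost : ∀ η : ℝ, cost F Q R V T x₀ (u + η • h) =
      (∫ t in Icc 0 T, (Q (X η t) + R ((u + η • h) t))) + V (X η T) := fun η => by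
    rw [cost, intervalIntegral.integral_of_le hT, ← integral_Icc_eq_integral_Ioc]
  simp_rw [hcost]
  rw [intervalIntegral.integral_of_le hT, ← integral_Icc_eq_integral_Ioc]
  exact hmain.add hVd

end Derivative

/-! ### Comparison with trajectories of the linearized system -/

theorem integral_norm_sq_le_of_eLpNorm_le {m : ℕ} {T ε : ℝ} (hT : 0 ≤ T) {g : ℝ → Euc m}
    (hg : MemLp g 2 (volume.restrict (Icc 0 T)))
    (hε : (eLpNorm g 2 (volume.restrict (Icc 0 T))).toReal ≤ ε) :
    ∫ t in (0 : ℝ)..T, ‖g t‖ ^ 2 ≤ ε ^ 2 := by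
  rw [intervalIntegral.integral_of_le hT, ← integral_Icc_eq_integral_Ioc]
  have hnn : 0 ≤ ∫ t in Icc 0 T, ‖g t‖ ^ 2 := integral_nonneg fun _ => by positivity
  rw [hg.eLpNorm_eq_integral_rpow_norm (by norm_num) (by norm_num)] at hε
  simp only [ENNReal.toReal_ofNat, Real.rpow_ofNat] at hε
  rw [ENNReal.toReal_ofReal (by positivity), ← one_div, ← Real.sqrt_eq_rpow] at hε
  have h1 := Real.sqrt_nonneg (∫ t in Icc 0 T, ‖g t‖ ^ 2)
  rw [← Real.sq_sqrt hnn]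
  gcongr

theorem integrable_inner_of_memLp {m : ℕ} {μ : Measure ℝ} {g h : ℝ → Euc m} (hg : MemLp g 2 μ)
    (hh : MemLp h 2 μ) : Integrable (fun t => inner ℝ (g t) (h t)) μ := by
  refine ((hg.integrable_norm_pow (p := 2) (by norm_num)).add
    (hh.integrable_norm_pow (p := 2) (by norm_num))).mono' (hg.1.inner hh.1)
    (Eventually.of_forall fun t => ?_)
  have h1 := norm_inner_le_norm (𝕜 := ℝ) (g t) (h t)
  simp only [Pi.add_apply]
  nlinarith [sq_nonneg (‖g t‖ - ‖h t‖), norm_nonneg (g t), norm_nonneg (h t)]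

theorem IsStabilizable.exists_lt {n m : ℕ} {γ T : ℝ} {A : ℝ → Euc n →L[ℝ] Euc n}
    {B : ℝ → Euc m →L[ℝ] Euc n} (h : IsStabilizable γ T A B) {s : ℝ} (hs : s ∈ Icc 0 T)
    (ξ : Euc n) {c : ℝ} (hc : γ * ‖ξ‖ ^ 2 < c) :
    ∃ v z, AdmissibleInput s T v ∧ IsSolution (fun τ y => A τ y + B τ (v τ)) s T ξ z ∧
      (∫ t in s..T, (‖z t‖ ^ 2 + ‖v t‖ ^ 2)) + ‖z T‖ ^ 2 < c := by
  have h1 := (h s hs ξ).trans_lt (EReal.coe_lt_coe_iff.2 hc)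
  simp only [iInf_lt_iff] at h1
  obtain ⟨v, z, hv, hz, hlt⟩ := h1
  exact ⟨v, z, hv, hz, EReal.coe_lt_coe_iff.1 hlt⟩

theorem IsSolution.eq_add_integral {n : ℕ} {f : ℝ → Euc n → Euc n} {a b : ℝ} {ξ : Euc n}
    {x : ℝ → Euc n} (hx : IsSolution f a b ξ x) {s t : ℝ} (hs : s ∈ Icc a b) (ht : t ∈ Icc a b) :
    x t = x s + ∫ τ in s..t, f τ (x τ) := by
  have hab := hs.1.trans hs.2
  have i : ∀ t ∈ Icc a b, IntervalIntegrable (fun τ => f τ (x τ)) volume a t := fun t ht =>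
    hx.integrable.mono_set (by
      rw [uIcc_of_le ht.1, uIcc_of_le hab]; exact Icc_subset_Icc_right ht.2)
  rw [hx.eq_integral t ht, hx.eq_integral s hs, add_assoc,
    intervalIntegral.integral_add_adjacent_intervals (i s hs) ((i s hs).symm.trans (i t ht))]

/-- Energy identity together with `2‖x‖(‖x‖ + ‖v‖) ≤ 3‖x‖² + ‖v‖²`. -/
theorem IsSolution.abs_norm_sq_sub_le {n m : ℕ} {f : ℝ → Euc n → Euc n} {a b L : ℝ} {ξ : Euc n}
    {x : ℝ → Euc n} {v : ℝ → Euc m} (hx : IsSolution f a b ξ x) (hv : AdmissibleInput a b v)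
    (hL : 0 ≤ L) (hf : ∀ τ, ‖f τ (x τ)‖ ≤ L * (‖x τ‖ + ‖v τ‖)) {s t : ℝ}
    (hs : s ∈ Icc a b) (ht : t ∈ Icc a b) (hst : s ≤ t) :
    |‖x t‖ ^ 2 - ‖x s‖ ^ 2| ≤ L * ∫ τ in s..t, (3 * ‖x τ‖ ^ 2 + ‖v τ‖ ^ 2) := by
  have hab := hs.1.trans hs.2
  have hsub : uIcc s t ⊆ uIcc a b := by
    rw [uIcc_of_le hst, uIcc_of_le hab]; exact Icc_subset_Icc hs.1 ht.2
  have hc : Continuous fun p : Euc n × Euc m => 3 * ‖p.1‖ ^ 2 + ‖p.2‖ ^ 2 := by fun_prop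
  rw [norm_sq_sub_norm_sq_eq_integral hst (hx.integrable.mono_set hsub) fun r hr =>
    hx.eq_add_integral hs ⟨hs.1.trans hr.1, hr.2.trans ht.2⟩,
    ← intervalIntegral.integral_const_mul, ← Real.norm_eq_abs]
  refine intervalIntegral.norm_integral_le_of_norm_le hst (Eventually.of_forall fun τ _ => ?_)
    (((memLp_top_comp hc hx.continuousOn hv).intervalIntegrable_of_top hs ht).const_mul L)
  have h1 := norm_inner_le_norm (𝕜 := ℝ) (x τ) (f τ (x τ))
  have h2 := mul_le_mul_of_nonneg_left (hf τ) (norm_nonneg (x τ))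
  rw [norm_mul, Real.norm_of_nonneg (by norm_num : (0 : ℝ) ≤ 2)]
  have h3 := mul_nonneg hL (sq_nonneg (‖x τ‖ - ‖v τ‖))
  linarith

section Comparison

variable {n m : ℕ} {F : Euc n × Euc m → Euc n} {LF T : ℝ} {x₀ : Euc n} {u v p : ℝ → Euc m}
  {x y : ℝ → Euc n} {s : ℝ}

theorem admissibleInput_pinv_drift (hF : ContDiff ℝ 1 F) (hu : AdmissibleInput 0 T u)
    (hx : ContinuousOn x (Icc 0 T)) {Lx Lu : ℝ} (hLx : 0 < Lx) (hLu : 0 < Lu)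
    (hp : ∀ t ∈ Icc 0 T,
      ‖pinv (jacB F (x t) (u t)) (drift F (x t) (u t))‖ ≤ Lx * ‖x t‖ + Lu * ‖u t‖) :
    AdmissibleInput 0 T fun t => pinv (jacB F (x t) (u t)) (drift F (x t) (u t)) := by
  obtain ⟨D, hD⟩ := isCompact_Icc.exists_bound_of_continuousOn hx
  obtain ⟨M, -, hM⟩ := hu.exists_bound
  have hm : AEMeasurable (fun t => (x t, u t)) (volume.restrict (Icc 0 T)) :=
    (hx.aestronglyMeasurable measurableSet_Icc).aemeasurable.prodMk hu.1.aemeasurable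
  have hmp := (measurable_pinv (continuous_jacB hF) (continuous_drift hF)).comp_aemeasurable hm
  refine memLp_top_of_bound hmp.aestronglyMeasurable (Lx * D + Lu * M) ?_
  filter_upwards [hM, ae_restrict_mem measurableSet_Icc] with t h1 h2
  have := hD t h2
  exact (hp t h2).trans (by gcongr)

/-- Because the drift equals `B p`, subtracting `ẋ = A x + B (u + p)` from `ẏ = A y + B v` leaves a
homogeneous linear system with input `v - p - u`. Writing `max s t` freezes the difference at its
value `0` before time `s`. -/
theorem isSolution_linearized_sub (hT : s ∈ Icc 0 T) (hx : IsTrajectory F T x₀ u x)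
    (hp : ∀ t ∈ Icc 0 T, jacB F (x t) (u t) (p t) = drift F (x t) (u t))
    (hy : IsSolution (fun τ y => jacA F (x τ) (u τ) y + jacB F (x τ) (u τ) (v τ)) s T (x s) y) :
    IsSolution (fun τ y => jacA F (x τ) (u τ) y
        + jacB F (x τ) (u τ) ((Ioc s T).indicator (fun t => v t - p t - u t) τ)) 0 T 0
      fun t => y (max s t) - x (max s t) := by
  have h0s : (0 : ℝ) ∈ Icc 0 T := ⟨le_rfl, hT.1.trans hT.2⟩
  have hsT : s ≤ T := hT.2
  have hys : y s = x s := by simpa using hy.eq_integral s ⟨le_rfl, hsT⟩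
  set k : ℝ → Euc n := fun τ => jacA F (x τ) (u τ) (y (max s τ) - x (max s τ))
        + jacB F (x τ) (u τ) ((Ioc s T).indicator (fun t => v t - p t - u t) τ) with hk
  have hk0 : ∀ τ, τ ≤ s → k τ = 0 := fun τ hτ => by
    simp only [hk, max_eq_left hτ, hys, sub_self, map_zero, zero_add]
    rw [indicator_of_notMem (fun h => absurd h.1 (not_lt.2 hτ)), map_zero]
  have hk1 : ∀ τ ∈ Ioc s T, (jacA F (x τ) (u τ) (y τ) + jacB F (x τ) (u τ) (v τ))
      - F (x τ, u τ) = k τ := fun τ hτ => by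
    have h1 := hp τ ⟨hT.1.trans hτ.1.le, hτ.2⟩
    simp only [hk, max_eq_right hτ.1.le, indicator_of_mem hτ, map_sub, h1, drift]
    abel
  have i0 : ∀ t, t ≤ s → IntervalIntegrable k volume 0 t := fun t ht => by
    refine (intervalIntegrable_const (c := (0 : Euc n))).congr fun τ hτ => ?_
    exact (hk0 τ (hτ.2.trans (max_le hT.1 ht))).symm
  have z0 : ∀ t, t ≤ s → ∫ τ in (0 : ℝ)..t, k τ = 0 := fun t ht => by
    rw [intervalIntegral.integral_congr_ae (g := fun _ => (0 : Euc n))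
      (Eventually.of_forall fun τ hτ => hk0 τ (hτ.2.trans (max_le hT.1 ht)))]
    simp
  have ix : ∀ t ∈ Icc s T, IntervalIntegrable (fun τ => F (x τ, u τ)) volume s t := fun t ht =>
    hx.integrable.mono_set (by
      rw [uIcc_of_le ht.1, uIcc_of_le h0s.2]; exact Icc_subset_Icc hT.1 ht.2)
  have iy : ∀ t ∈ Icc s T, IntervalIntegrable
      (fun τ => jacA F (x τ) (u τ) (y τ) + jacB F (x τ) (u τ) (v τ)) volume s t := fun t ht =>
    hy.integrable.mono_set (by
      rw [uIcc_of_le ht.1, uIcc_of_le hsT]; exact Icc_subset_Icc_right ht.2)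
  have i1 : ∀ t ∈ Icc s T, IntervalIntegrable k volume s t := fun t ht =>
    ((iy t ht).sub (ix t ht)).congr fun τ hτ => by
      rw [uIoc_of_le ht.1] at hτ
      exact hk1 τ ⟨hτ.1, hτ.2.trans ht.2⟩
  have hTs : T ∈ Icc s T := ⟨hsT, le_rfl⟩
  have hmax : MapsTo (fun t => max s t) (Icc 0 T) (Icc s T) := fun t ht =>
    ⟨le_max_left _ _, max_le hsT ht.2⟩
  refine ⟨?_, (i0 s le_rfl).trans (i1 T hTs), fun t ht => ?_⟩
  · refine ContinuousOn.sub (hy.continuousOn.comp (by fun_prop) hmax)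
      (hx.continuousOn.comp (by fun_prop) fun t ht => ?_)
    exact ⟨hT.1.trans (hmax ht).1, (hmax ht).2⟩
  · change _ = 0 + ∫ τ in (0 : ℝ)..t, k τ
    rcases le_total t s with hts | hst
    · simp only [max_eq_left hts, hys, sub_self, z0 t hts, add_zero]
    · have htT : t ∈ Icc s T := ⟨hst, ht.2⟩
      rw [← intervalIntegral.integral_add_adjacent_intervals (i0 s le_rfl) (i1 t htT),
        z0 s le_rfl, intervalIntegral.integral_congr_ae (g := fun τ =>
          (jacA F (x τ) (u τ) (y τ) + jacB F (x τ) (u τ) (v τ)) - F (x τ, u τ))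
          (Eventually.of_forall fun τ hτ => by
            rw [uIoc_of_le hst] at hτ
            exact (hk1 τ ⟨hτ.1, hτ.2.trans ht.2⟩).symm),
        intervalIntegral.integral_sub (iy t htT) (ix t htT)]
      have e1 := hy.eq_add_integral ⟨le_rfl, hsT⟩ htT
      have e2 := IsSolution.eq_add_integral hx hT ht
      simp only [max_eq_right hst]
      rw [e1, e2, hys]
      abel

/-- Approximate stationarity acts like approximate optimality against linearized competitors: the
gradient is tested on the one direction whose first variation is `y - x`, and convexity does the
rest. -/
theorem cost_le_linearized_cost (hF : ContDiff ℝ 1 F) (hLF : 0 < LF)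
    (hFLip : ∀ x₁ x₂ u₁ u₂, ‖F (x₁, u₁) - F (x₂, u₂)‖ ≤ LF * (‖x₁ - x₂‖ + ‖u₁ - u₂‖))
    {Q : Euc n → ℝ} {R : Euc m → ℝ} {V : Euc n → ℝ} {αQ βQ αR βR αV βV ε : ℝ}
    (hαQ : 0 < αQ) (hQ : IsCost αQ βQ Q) (hαR : 0 < αR) (hR : IsCost αR βR R)
    (hαV : 0 ≤ αV) (hV : IsCost αV βV V)
    (hu : IsFOS T ε (cost F Q R V T x₀) u) (hs : s ∈ Icc 0 T) (hx : IsTrajectory F T x₀ u x)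
    (hpa : AdmissibleInput 0 T p)
    (hp : ∀ t ∈ Icc 0 T, jacB F (x t) (u t) (p t) = drift F (x t) (u t))
    (hv : AdmissibleInput s T v)
    (hy : IsSolution (fun τ y => jacA F (x τ) (u τ) y + jacB F (x τ) (u τ) (v τ)) s T (x s) y) :
    (∫ t in s..T, (Q (x t) + R (u t))) + V (x T) ≤
      (∫ t in s..T, (Q (y t) + R (v t - p t))) + V (y T) + ε ^ 2 / (2 * αR) := by
  obtain ⟨hua, g, ⟨hg, hgd⟩, hgε⟩ := hu
  have hT : 0 ≤ T := hs.1.trans hs.2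
  have hsT : s ≤ T := hs.2
  have hIcc : Icc s T ⊆ Icc 0 T := Icc_subset_Icc_left hs.1
  have hxs : ContinuousOn x (Icc s T) := hx.continuousOn.mono hIcc
  set h : ℝ → Euc m := (Ioc s T).indicator fun t => v t - p t - u t with hh
  have hh0 : ∀ t, t ≤ s → h t = 0 := fun t ht =>
    indicator_of_notMem (fun h => absurd h.1 (not_lt.2 ht)) _
  have hh1 : ∀ t ∈ Ioc s T, h t = v t - p t - u t := fun t ht => indicator_of_mem ht _
  have hvp : AdmissibleInput s T fun t => v t - p t := MemLp.sub hv (hpa.mono hIcc)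
  have hha : AdmissibleInput 0 T h := by
    refine (memLp_indicator_iff_restrict measurableSet_Ioc).2 ?_
    rw [Measure.restrict_restrict_of_subset (Ioc_subset_Icc_self.trans hIcc)]
    exact (MemLp.sub hvp (hua.mono hIcc)).mono_measure
      (Measure.restrict_mono Ioc_subset_Icc_self le_rfl)
  set z : ℝ → Euc n := fun t => y (max s t) - x (max s t) with hzdef
  have hz : IsSolution (fun τ y => jacA F (x τ) (u τ) y + jacB F (x τ) (u τ) (h τ)) 0 T 0 z :=
    isSolution_linearized_sub hs hx hp hy
  have hz0 : ∀ t, t ≤ s → z t = 0 := fun t ht => by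
    have hys : y s = x s := by simpa using hy.eq_integral s ⟨le_rfl, hsT⟩
    simp only [hzdef, max_eq_left ht, hys, sub_self]
  have hz1 : ∀ t, s ≤ t → z t = y t - x t := fun t ht => by
    simp only [hzdef, max_eq_right ht]
  -- Two expressions for the same directional derivative: the chain rule along `z`, and the pairing
  -- with the gradient `g`.
  have hD := (hasDerivAt_cost hF hLF hFLip (hQ.contDiff.of_le (by norm_num))
    (hR.contDiff.of_le (by norm_num)) (hV.contDiff.of_le (by norm_num)) hT hua hx hha hz).unique
    (hgd h hha)
  set ψ₁ : ℝ → ℝ := fun t => fderiv ℝ Q (x t) (z t) + fderiv ℝ R (u t) (h t) with hψ₁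
  set ψ₂ : ℝ → ℝ := fun t => inner ℝ (g t) (h t) with hψ₂
  have hap : Continuous fun p : Euc m × Euc m => fderiv ℝ R p.1 p.2 :=
    (hR.continuous_fderiv.comp continuous_fst).clm_apply continuous_snd
  have i1 : IntegrableOn ψ₁ (Icc 0 T) := by
    refine Integrable.add ?_ ?_
    · exact ((hQ.continuous_fderiv.comp_continuousOn hx.continuousOn).clm_apply
        hz.continuousOn).integrableOn_Icc
    · obtain ⟨M, -, hM⟩ := hua.exists_bound
      obtain ⟨N, hN0, hN⟩ := hha.exists_bound
      obtain ⟨D, hD⟩ := (isCompact_closedBall (0 : Euc m) M).exists_bound_of_continuousOn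
        hR.continuous_fderiv.continuousOn
      refine (memLp_top_of_bound (hap.comp_aestronglyMeasurable (hua.1.prodMk hha.1)) (D * N)
        ?_).integrable (by simp)
      filter_upwards [hM, hN] with t h1 h2
      have h3 := hD _ (mem_closedBall_zero_iff.2 h1)
      refine ((fderiv ℝ R (u t)).le_opNorm _).trans ?_
      exact mul_le_mul h3 h2 (norm_nonneg _) ((norm_nonneg _).trans h3)
  have i2 : IntegrableOn ψ₂ (Icc 0 T) :=
    integrable_inner_of_memLp hg (hha.mono_exponent le_top)
  have ii : ∀ {ψ : ℝ → ℝ}, IntegrableOn ψ (Icc 0 T) → ∀ a ∈ Icc 0 T, ∀ b ∈ Icc 0 T,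
      IntervalIntegrable ψ volume a b := fun hψ a ha b hb =>
    (hψ.mono_set (ordConnected_Icc.uIcc_subset ha hb)).intervalIntegrable
  have h0m : (0 : ℝ) ∈ Icc 0 T := left_mem_Icc.2 hT
  have hTm : T ∈ Icc 0 T := right_mem_Icc.2 hT
  have split : ∀ {ψ : ℝ → ℝ}, IntegrableOn ψ (Icc 0 T) → (∀ t, t ≤ s → ψ t = 0) →
      ∫ t in (0 : ℝ)..T, ψ t = ∫ t in s..T, ψ t := fun {ψ} hψ hψ0 => by
    rw [← intervalIntegral.integral_add_adjacent_intervals (ii hψ 0 h0m s hs) (ii hψ s hs T hTm),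
      intervalIntegral.integral_congr_ae (a := 0) (b := s) (g := fun _ => (0 : ℝ))
      (Eventually.of_forall fun τ hτ => hψ0 τ (by rw [uIoc_of_le hs.1] at hτ; exact hτ.2))]
    simp
  rw [split i1 fun t ht => by simp [hψ₁, hz0 t ht, hh0 t ht],
    split i2 fun t ht => by simp [hψ₂, hh0 t ht], hz1 T hsT] at hD
  have ig : IntegrableOn (fun t => ‖g t‖ ^ 2) (Icc 0 T) :=
    hg.integrable_norm_pow (p := 2) (by norm_num)
  have hQR : Continuous fun p : Euc n × Euc m => Q p.1 + R p.2 :=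
    (hQ.contDiff.continuous.comp continuous_fst).add (hR.contDiff.continuous.comp continuous_snd)
  have ixu : IntervalIntegrable (fun t => Q (x t) + R (u t)) volume s T :=
    (memLp_top_comp hQR hxs (hua.mono hIcc)).intervalIntegrable_of_top
      (left_mem_Icc.2 hsT) (right_mem_Icc.2 hsT)
  have iyv : IntervalIntegrable (fun t => Q (y t) + R (v t - p t)) volume s T :=
    (memLp_top_comp hQR hy.continuousOn hvp).intervalIntegrable_of_top
      (left_mem_Icc.2 hsT) (right_mem_Icc.2 hsT)
  have igs := (ii ig s hs T hTm).const_mul (1 / (2 * αR))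
  have hmono : ∫ t in s..T, (ψ₁ t - ψ₂ t) ≤ ∫ t in s..T, (((Q (y t) + R (v t - p t))
      - (Q (x t) + R (u t))) + 1 / (2 * αR) * ‖g t‖ ^ 2) := by
    refine intervalIntegral.integral_mono_on_of_le_Ioo hsT
      ((ii i1 s hs T hTm).sub (ii i2 s hs T hTm)) ((iyv.sub ixu).add igs) fun t ht => ?_
    simp only [hψ₁, hψ₂, hz1 t ht.1.le, hh1 t ⟨ht.1, ht.2.le⟩]
    have e1 := hQ.lower_bound (x t) (y t)
    have e2 := hR.lower_bound (u t) (v t - p t)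
    -- From `Q` plain convexity is enough; only the quadratic term of `R` is kept, to absorb `⟨g,
    -- h⟩` by Young's inequality.
    have e3 : 0 ≤ αQ / 2 * ‖y t - x t‖ ^ 2 := by positivity
    have e4 : -inner ℝ (g t) (v t - p t - u t) ≤
        1 / (2 * αR) * ‖g t‖ ^ 2 + αR / 2 * ‖v t - p t - u t‖ ^ 2 := by
      have f1 := abs_real_inner_le_norm (g t) (v t - p t - u t)
      have f2 := neg_abs_le (inner ℝ (g t) (v t - p t - u t))
      have f3 : 1 / (2 * αR) * ‖g t‖ ^ 2 + αR / 2 * ‖v t - p t - u t‖ ^ 2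
          - ‖g t‖ * ‖v t - p t - u t‖
          = 1 / (2 * αR) * (‖g t‖ - αR * ‖v t - p t - u t‖) ^ 2 := by
        field_simp; ring
      have f4 : 0 ≤ 1 / (2 * αR) * (‖g t‖ - αR * ‖v t - p t - u t‖) ^ 2 := by positivity
      linarith
    linarith
  rw [intervalIntegral.integral_sub (ii i1 s hs T hTm) (ii i2 s hs T hTm),
    intervalIntegral.integral_add (iyv.sub ixu) igs, intervalIntegral.integral_sub iyv ixu,
    intervalIntegral.integral_const_mul] at hmono
  have hg2 : ∫ t in s..T, ‖g t‖ ^ 2 ≤ ε ^ 2 :=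
    (intervalIntegral.integral_mono_interval hs.1 hsT le_rfl
      (Eventually.of_forall fun _ => by positivity) (ii ig 0 h0m T hTm)).trans
      (integral_norm_sq_le_of_eLpNorm_le hT hg hgε)
  have hg3 : 1 / (2 * αR) * ∫ t in s..T, ‖g t‖ ^ 2 ≤ ε ^ 2 / (2 * αR) := by
    calc _ ≤ 1 / (2 * αR) * ε ^ 2 := by gcongr
      _ = _ := by ring
  have hV1 := hV.lower_bound (x T) (y T)
  have hV2 : 0 ≤ αV / 2 * ‖y T - x T‖ ^ 2 := by positivity
  linarith

end Comparison

/-! ### Exponential decay of the remaining energy -/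

/-- Let `Y` be the tail plus `c` minus `e`. Formally `Y' = -w ≤ -q ≤ -Y / C`, so `Y` decays at rate
`1/C`; the integral Gronwall inequality makes this rigorous for merely integrable `w`. -/
theorem tail_integral_le_exp_decay {T C e c : ℝ} {w q : ℝ → ℝ} (hC : 0 < C)
    (hw : IntegrableOn w (Icc 0 T))
    (hqw : ∀ t ∈ Icc 0 T, q t ≤ w t)
    (hW : ∀ s ∈ Icc 0 T, (∫ t in s..T, w t) + c ≤ C * q s + e) :
    ∀ s ∈ Icc 0 T, (∫ t in s..T, w t) + c ≤ C * Real.exp (-(s / C)) * q 0 + e := by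
  intro s hs
  have hT : 0 ≤ T := hs.1.trans hs.2
  have h0m : (0 : ℝ) ∈ Icc 0 T := left_mem_Icc.2 hT
  have hTm : T ∈ Icc 0 T := right_mem_Icc.2 hT
  have iw : ∀ a ∈ Icc 0 T, ∀ b ∈ Icc 0 T, IntervalIntegrable w volume a b := fun a ha b hb =>
    (hw.mono_set (ordConnected_Icc.uIcc_subset ha hb)).intervalIntegrable
  set Y : ℝ → ℝ := fun s => (∫ t in s..T, w t) + c - e with hY
  have hYc : ContinuousOn Y (Icc 0 T) := by
    have h1 := intervalIntegral.continuousOn_primitive_interval' (iw 0 h0m T hTm) left_mem_uIcc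
    rw [uIcc_of_le hT] at h1
    refine ((((continuousOn_const (c := ∫ t in (0 : ℝ)..T, w t)).sub h1).add
      (continuousOn_const (c := c))).sub (continuousOn_const (c := e))).congr fun t ht => ?_
    simp only [hY, Pi.sub_apply, Pi.add_apply,
      ← intervalIntegral.integral_add_adjacent_intervals (iw 0 h0m t ht) (iw t ht T hTm)]
    ring
  have hsub : Icc 0 s ⊆ Icc 0 T := Icc_subset_Icc_right hs.2
  have key := mul_exp_le_of_add_integral_le (L := 1 / C) hs.1 (by positivity) (hYc.mono hsub)
    fun r hr => by
    have hrT := hsub hr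
    have e1 : Y r = Y s + ∫ t in r..s, w t := by
      simp only [hY, ← intervalIntegral.integral_add_adjacent_intervals (iw r hrT s hs)
        (iw s hs T hTm)]
      ring
    rw [e1, ← intervalIntegral.integral_const_mul]
    have iY : IntervalIntegrable Y volume r s :=
      (hYc.mono (ordConnected_Icc.uIcc_subset hrT hs)).intervalIntegrable
    have := intervalIntegral.integral_mono_on hr.2 (iY.const_mul (1 / C)) (iw r hrT s hs)
      fun t ht => by
        have ht' : t ∈ Icc 0 T := ⟨hr.1.trans ht.1, ht.2.trans hs.2⟩
        have h1 : Y t ≤ C * q t := by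
          simp only [hY]; linarith [hW t ht']
        calc 1 / C * Y t ≤ 1 / C * (C * q t) := by gcongr
          _ = q t := by field_simp
          _ ≤ w t := hqw t ht'
    linarith
  have h0 : Y 0 ≤ C * q 0 := by
    simp only [hY]; linarith [hW 0 h0m]
  have h1 : Y s ≤ C * Real.exp (-(s / C)) * q 0 := by
    have h2 : Y s * Real.exp (1 / C * s) ≤ C * q 0 := key.trans h0
    rw [← le_div_iff₀ (Real.exp_pos _)] at h2
    refine h2.trans (le_of_eq ?_)
    rw [Real.exp_neg, one_div_mul_eq_div]
    ring
  simp only [hY] at h1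
  linarith

/-- Average the bound on `q s` over starting times `t ∈ [r, s]`: the term `q t ≤ w t` costs the
factor `1 / (s - r)`. -/
theorem le_mul_integral_of_sub_le {K r s : ℝ} {w q : ℝ → ℝ} (hrs : r < s) (hK : 0 ≤ K)
    (hw : IntervalIntegrable w volume r s) (hw0 : ∀ t, 0 ≤ w t) (hqw : ∀ t, q t ≤ w t)
    (h : ∀ t ∈ Icc r s, q s ≤ q t + K * ∫ τ in t..s, w τ) :
    q s ≤ (K + 1 / (s - r)) * ∫ τ in r..s, w τ := by
  have h1 : ∀ t ∈ Icc r s, q s ≤ w t + K * ∫ τ in r..s, w τ := fun t ht => by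
    have h2 : ∫ τ in t..s, w τ ≤ ∫ τ in r..s, w τ :=
      intervalIntegral.integral_mono_interval ht.1 ht.2 le_rfl (Eventually.of_forall hw0) hw
    have h3 := mul_le_mul_of_nonneg_left h2 hK
    linarith [h t ht, hqw t]
  have h2 := intervalIntegral.integral_mono_on hrs.le intervalIntegrable_const
    (hw.add intervalIntegrable_const) h1
  rw [intervalIntegral.integral_add hw intervalIntegrable_const,
    intervalIntegral.integral_const, intervalIntegral.integral_const, smul_eq_mul,
    smul_eq_mul] at h2
  have hpos : 0 < s - r := sub_pos.2 hrs
  refine le_of_mul_le_mul_left (h2.trans (le_of_eq ?_)) hpos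
  field_simp
  ring

/-- The minimum selects the window `δ` or `ρ`. A window fitting in `[0, s]` uses `havg`: for `δ` the
loss `exp (δ / C)` is in the statement, for `ρ` the condition `4ρ ≤ C` makes it at most `2`.
Otherwise `hinit` applies, its bare `X` being absorbed through `hKC` or `hρC`. -/
theorem le_of_average_bounds {K C E X q s δ ρ : ℝ} (hK : 0 < K) (hC : 0 < C) (hE : 0 ≤ E)
    (hX : 0 ≤ X) (hδ : 0 < δ) (hρ : 0 < ρ) (hKC : X ≤ K * C * X)
    (hρC : X ≠ 0 → 4 * ρ ≤ C) (hinit : q ≤ X + K * (C * X + 2 * E))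
    (havg : ∀ σ, 0 < σ → σ ≤ s →
      q ≤ (K + 1 / σ) * (C * (Real.exp (σ / C) * Real.exp (-(s / C))) * X + 2 * E)) :
    q ≤ (2 * K + min (2 / δ) (2 * (1 / ρ))) *
      (Real.exp (δ / C) * C * Real.exp (-(s / C)) * X + E) := by
  rcases le_total (2 / δ) (2 * (1 / ρ)) with hmin | hmin
  · rw [min_eq_left hmin]
    rcases le_or_gt δ s with hδs | hδs
    · have hM : 0 ≤ C * (Real.exp (δ / C) * Real.exp (-(s / C))) * X := by positivity
      calc q ≤ _ := havg δ hδ hδs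
        _ ≤ (K + 1 / δ) * (2 * (C * (Real.exp (δ / C) * Real.exp (-(s / C))) * X + E)) :=
          mul_le_mul_of_nonneg_left (by linarith) (by positivity)
        _ = _ := by ring
    · have h5 : 1 ≤ Real.exp (δ / C) * Real.exp (-(s / C)) := by
        rw [← Real.exp_add]
        refine Real.one_le_exp ?_
        rw [show δ / C + -(s / C) = (δ - s) / C by ring]
        exact div_nonneg (by linarith) hC.le
      have hCX : 0 ≤ C * X := by positivity
      calc q ≤ 2 * K * (C * X + E) := by linarith
        _ ≤ (2 * K + 2 / δ) * ((Real.exp (δ / C) * Real.exp (-(s / C))) * (C * X) + E) :=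
          mul_le_mul (le_add_of_nonneg_right (by positivity))
            (by linarith [le_mul_of_one_le_left hCX h5]) (by positivity) (by positivity)
        _ = _ := by ring
  · rw [min_eq_right hmin]
    have hMs : 0 ≤ C * Real.exp (-(s / C)) * X := by positivity
    suffices hsuff : q ≤ (2 * K + 2 * (1 / ρ)) * (C * Real.exp (-(s / C)) * X + E) by
      refine hsuff.trans (mul_le_mul_of_nonneg_left ?_ (by positivity))
      have := le_mul_of_one_le_left hMs (Real.one_le_exp (by positivity : 0 ≤ δ / C))
      linarith
    rcases eq_or_ne X 0 with rfl | hX0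
    · have h5 : 0 ≤ 2 * (1 / ρ) * E := by positivity
      linarith
    have hρC4 := hρC hX0
    have hexp : 3 / 4 ≤ Real.exp (-(ρ / C)) := by
      have h1 : ρ / C ≤ 1 / 4 := by rw [div_le_iff₀ hC]; linarith
      linarith [Real.one_sub_le_exp_neg (ρ / C)]
    rcases le_or_gt ρ s with hρs | hρs
    · have h5 : Real.exp (ρ / C) ≤ 2 := by
        have e1 : Real.exp (ρ / C) * Real.exp (-(ρ / C)) = 1 := by
          rw [← Real.exp_add, add_neg_cancel, Real.exp_zero]
        have e2 := mul_le_mul_of_nonneg_left hexp (Real.exp_pos (ρ / C)).le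
        linarith
      calc q ≤ _ := havg ρ hρ hρs
        _ ≤ (K + 1 / ρ) * (C * (2 * Real.exp (-(s / C))) * X + 2 * E) := by gcongr
        _ = _ := by ring
    · have h5 : 3 / 4 ≤ Real.exp (-(s / C)) := hexp.trans (by gcongr)
      have h6 : 4 ≤ 1 / ρ * C := by
        rw [one_div_mul_eq_div, le_div_iff₀ hρ]; exact hρC4
      have h7 : C * X ≤ 2 * (C * Real.exp (-(s / C)) * X) := by
        have e1 := mul_le_mul_of_nonneg_left h5 (by positivity : 0 ≤ C * X)
        have e2 : 0 ≤ C * X := by positivity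
        linarith
      have h8 : X ≤ 2 * (1 / ρ) * (C * Real.exp (-(s / C)) * X) := by
        have e1 := mul_le_mul h6 h5 (by norm_num) (by positivity)
        have e2 := mul_le_mul_of_nonneg_right e1 hX
        linarith
      have h9 := mul_le_mul_of_nonneg_left h7 hK.le
      have h10 : 0 ≤ 2 * (1 / ρ) * E := by positivity
      linarith

/-! ### Lower bounds on the stabilizability constant -/

section Gamma

variable {n m : ℕ} {F : Euc n × Euc m → Euc n} {LF γ : ℝ}

theorem isTrajectory_zero (hF0 : F (0, 0) = 0) (T : ℝ) :
    IsTrajectory F T 0 (fun _ => 0) fun _ => 0 where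
  continuousOn := continuousOn_const
  integrable := by simp [hF0]
  eq_integral := by simp [hF0]

/-- At horizon `0` only the terminal cost `‖ξ‖²` remains. -/
theorem one_le_of_isStabilizable {A : ℝ → Euc n →L[ℝ] Euc n} {B : ℝ → Euc m →L[ℝ] Euc n}
    (h : IsStabilizable γ 0 A B) {ξ : Euc n} (hξ : ξ ≠ 0) : 1 ≤ γ := by
  by_contra! hlt
  have hpos : 0 < ‖ξ‖ ^ 2 := by positivity
  obtain ⟨v, z, -, hz, hc⟩ := h.exists_lt (left_mem_Icc.2 le_rfl) ξ
    (c := ‖ξ‖ ^ 2) (by nlinarith)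
  have hz0 : z 0 = ξ := by simpa using hz.eq_integral 0 (left_mem_Icc.2 le_rfl)
  simp [hz0] at hc

/-- The state cannot decay quickly at small cost: if the energy is `I`, then `‖z‖² ≥ ‖ξ‖² - 3 LF I`
throughout. Integrating over a horizon `4γ` with `I < 2γ‖ξ‖²` forces the bound. -/
theorem one_le_mul_of_isStabilizable (hLF : 0 < LF) (hγ : 0 < γ)
    {A : ℝ → Euc n →L[ℝ] Euc n} {B : ℝ → Euc m →L[ℝ] Euc n}
    (hA : ∀ t y, ‖A t y‖ ≤ LF * ‖y‖) (hB : ∀ t v, ‖B t v‖ ≤ LF * ‖v‖)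
    (h : IsStabilizable γ (4 * γ) A B) {ξ : Euc n} (hξ : ξ ≠ 0) : 1 ≤ 12 * LF * γ := by
  have hpos : 0 < ‖ξ‖ ^ 2 := by positivity
  have h0m : (0 : ℝ) ∈ Icc 0 (4 * γ) := ⟨le_rfl, by positivity⟩
  have hTm : 4 * γ ∈ Icc 0 (4 * γ) := ⟨by positivity, le_rfl⟩
  obtain ⟨v, z, hv, hz, hc⟩ := h.exists_lt h0m ξ (c := 2 * γ * ‖ξ‖ ^ 2) (by nlinarith)
  have hz0 : z 0 = ξ := by simpa using hz.eq_integral 0 h0m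
  have hcont : Continuous fun p : Euc n × Euc m => ‖p.1‖ ^ 2 + ‖p.2‖ ^ 2 := by fun_prop
  have iw : ∀ a ∈ Icc 0 (4 * γ), ∀ b ∈ Icc 0 (4 * γ),
      IntervalIntegrable (fun t => ‖z t‖ ^ 2 + ‖v t‖ ^ 2) volume a b := fun a ha b hb =>
    (memLp_top_comp hcont hz.continuousOn hv).intervalIntegrable_of_top ha hb
  set I := ∫ t in (0 : ℝ)..(4 * γ), (‖z t‖ ^ 2 + ‖v t‖ ^ 2) with hI
  have hI2 : I < 2 * γ * ‖ξ‖ ^ 2 := by linarith [sq_nonneg ‖z (4 * γ)‖]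
  have hcont3 : Continuous fun p : Euc n × Euc m => 3 * ‖p.1‖ ^ 2 + ‖p.2‖ ^ 2 := by fun_prop
  have h1 : ∀ t ∈ Icc 0 (4 * γ), ‖ξ‖ ^ 2 - LF * (3 * I) ≤ ‖z t‖ ^ 2 + ‖v t‖ ^ 2 := fun t ht => by
    have e1 := hz.abs_norm_sq_sub_le hv hLF.le (fun τ => by
      refine (norm_add_le _ _).trans ?_
      linarith [hA τ (z τ), hB τ (v τ)]) h0m ht ht.1
    have e2 : ∫ τ in (0 : ℝ)..t, (3 * ‖z τ‖ ^ 2 + ‖v τ‖ ^ 2) ≤ 3 * I := by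
      calc _ ≤ ∫ τ in (0 : ℝ)..t, 3 * (‖z τ‖ ^ 2 + ‖v τ‖ ^ 2) :=
            intervalIntegral.integral_mono_on ht.1
              ((memLp_top_comp hcont3 hz.continuousOn hv).intervalIntegrable_of_top h0m ht)
              ((iw 0 h0m t ht).const_mul 3) fun τ _ => by nlinarith [sq_nonneg ‖v τ‖]
        _ = 3 * ∫ τ in (0 : ℝ)..t, (‖z τ‖ ^ 2 + ‖v τ‖ ^ 2) :=
            intervalIntegral.integral_const_mul _ _
        _ ≤ 3 * I := by
            gcongr
            exact intervalIntegral.integral_mono_interval le_rfl ht.1 ht.2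
              (Eventually.of_forall fun _ => by positivity) (iw 0 h0m _ hTm)
    have e3 := mul_le_mul_of_nonneg_left e2 hLF.le
    have e4 := neg_abs_le (‖z t‖ ^ 2 - ‖z 0‖ ^ 2)
    rw [hz0] at e1 e4
    linarith [sq_nonneg ‖v t‖]
  have h2 := intervalIntegral.integral_mono_on hTm.1 intervalIntegrable_const
    (iw 0 h0m _ hTm) h1
  rw [intervalIntegral.integral_const, smul_eq_mul, sub_zero, ← hI] at h2
  have h3 : 4 * γ * (LF * (3 * I)) ≤ 4 * γ * (LF * (3 * (2 * γ * ‖ξ‖ ^ 2))) := by gcongr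
  have h4 : 0 < (γ * ‖ξ‖ ^ 2) * (24 * LF * γ - 2) := by linarith
  have h5 := pos_of_mul_pos_right h4 (by positivity)
  linarith

end Gamma

/-! ### The energy estimate at a stationary point -/

theorem constC1_pos {γ αQ βQ βR βV : ℝ} (hγ : 0 < γ) (hαQ : 0 < αQ) (hβR : 0 < βR) :
    0 < constC1 γ αQ βQ βR βV := by
  have : 0 < max βV (max βR βQ) := lt_max_of_lt_right (lt_max_of_lt_left hβR)
  rw [constC1]; positivity

theorem constC2_pos {αQ αR βR Lx Lu : ℝ} (hαQ : 0 < αQ) (hαR : 0 < αR) (hβR : 0 < βR) :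
    0 < constC2 αQ αR βR Lx Lu := by
  have : 0 ≤ max (Lx ^ 2 / αQ) (Lu ^ 2 / αR) := le_max_of_le_left (by positivity)
  rw [constC2]; positivity

theorem mul_max_le_one {αQ αR βR Lx Lu : ℝ} (hαQ : 0 < αQ) (hαR : 0 < αR) (hβR : 0 < βR)
    (hLu' : Lu ^ 2 ≤ αR / (8 * βR)) (hLx' : Lx ^ 2 ≤ αQ / (8 * βR)) :
    8 * βR * max (Lx ^ 2 / αQ) (Lu ^ 2 / αR) ≤ 1 := by
  have : max (Lx ^ 2 / αQ) (Lu ^ 2 / αR) ≤ 1 / (8 * βR) := by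
    refine max_le ?_ ?_
    · rw [div_le_iff₀ hαQ]; exact hLx'.trans (le_of_eq (by ring))
    · rw [div_le_iff₀ hαR]; exact hLu'.trans (le_of_eq (by ring))
  calc _ ≤ 8 * βR * (1 / (8 * βR)) := by gcongr
    _ = 1 := by field_simp

theorem mul_sq_le_of_le_add {αQ αR βR Lx Lu a b c : ℝ} (hαQ : 0 < αQ) (hαR : 0 < αR)
    (hβR : 0 < βR) (hc0 : 0 ≤ c) (hc : c ≤ Lx * a + Lu * b) :
    βR * c ^ 2 ≤ 8 * βR * max (Lx ^ 2 / αQ) (Lu ^ 2 / αR) / 4 * (αQ * a ^ 2 + αR * b ^ 2) := by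
  set μ := max (Lx ^ 2 / αQ) (Lu ^ 2 / αR)
  have h1 : Lx ^ 2 ≤ μ * αQ := (div_le_iff₀ hαQ).1 (le_max_left _ _)
  have h2 : Lu ^ 2 ≤ μ * αR := (div_le_iff₀ hαR).1 (le_max_right _ _)
  have h3 : c ^ 2 ≤ (Lx * a + Lu * b) ^ 2 := by gcongr
  have h4 : c ^ 2 ≤ 2 * (μ * αQ * a ^ 2 + μ * αR * b ^ 2) := by
    have e1 := mul_le_mul_of_nonneg_right h1 (sq_nonneg a)
    have e2 := mul_le_mul_of_nonneg_right h2 (sq_nonneg b)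
    nlinarith [sq_nonneg (Lx * a - Lu * b)]
  have h5 := mul_le_mul_of_nonneg_left h4 hβR.le
  linarith

/-- Multiply by `2(1 + θ)`: for `0 ≤ θ ≤ 1` the coefficient of `I` becomes `1 + θ(1 - θ)/2 ≥ 1`, and
`2(1 + θ) ≤ 4` on the `γ` term. This is the source of both `constC1` and `constC2`. -/
theorem scaled_energy_bound {αQ αR γ b θ I v X E : ℝ} (hαQ : 0 < αQ) (hαR : 0 < αR)
    (hγ : 0 < γ) (hb : 0 < b) (hθ0 : 0 ≤ θ) (hθ1 : θ ≤ 1) (hI : 0 ≤ I) (hv : 0 ≤ v)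
    (hX : 0 ≤ X) (h : (1 / 2 - θ / 4) * I + 1 / 2 * v ≤ b * (γ * X) + E / (2 * αR)) :
    (I + v) / αQ ≤ 4 * γ * b / αQ * X + 2 * (1 / (2 * αR * αQ) * (1 + θ)) * E := by
  have h1 := mul_le_mul_of_nonneg_left h (by positivity : 0 ≤ 2 * (1 + θ))
  have hθ' := sub_nonneg.2 hθ1
  have h2 : 0 ≤ θ * (1 - θ) * I := by positivity
  have h3 : 0 ≤ θ * v := by positivity
  have h4 : 0 ≤ (1 - θ) * (b * (γ * X)) := by positivity
  have h5 : E / (2 * αR) = E / αR / 2 := by field_simp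
  rw [h5] at h1
  have h6 : I + v ≤ 4 * (b * (γ * X)) + (1 + θ) * (E / αR) := by linarith
  calc (I + v) / αQ ≤ (4 * (b * (γ * X)) + (1 + θ) * (E / αR)) / αQ := by gcongr
    _ = _ := by field_simp

section Energy

variable {n m : ℕ} {F : Euc n × Euc m → Euc n} {LF T : ℝ} {x₀ : Euc n} {u p : ℝ → Euc m}
  {x : ℝ → Euc n}

/-- The Hessian bounds turn `cost_le_linearized_cost` into an inequality between quadratic energies.
Splitting `‖v - p‖² ≤ 2‖v‖² + 2‖p‖²`, the `p` part is at most `θ/4` of the energy of `(x, u)` and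
moves to the left. -/
theorem energy_le (hF : ContDiff ℝ 1 F) (hLF : 0 < LF)
    (hFLip : ∀ x₁ x₂ u₁ u₂, ‖F (x₁, u₁) - F (x₂, u₂)‖ ≤ LF * (‖x₁ - x₂‖ + ‖u₁ - u₂‖))
    {Q : Euc n → ℝ} {R : Euc m → ℝ} {V : Euc n → ℝ} {αQ βQ αR βR αV βV γ Lx Lu ε : ℝ}
    (hαQ : 0 < αQ) (hQ : IsCost αQ βQ Q)
    (hαR : 0 < αR) (hαβR : αR ≤ βR) (hR : IsCost αR βR R)
    (hαV : 0 ≤ αV) (hV : IsCost αV βV V)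
    (hLu' : Lu ^ 2 ≤ αR / (8 * βR)) (hLx' : Lx ^ 2 ≤ αQ / (8 * βR)) (hγ : 0 < γ)
    (hu : IsFOS T ε (cost F Q R V T x₀) u) (hx : IsTrajectory F T x₀ u x)
    (hstab : IsStabilizable γ T (fun t => jacA F (x t) (u t)) (fun t => jacB F (x t) (u t)))
    (hpa : AdmissibleInput 0 T p)
    (hp : ∀ t ∈ Icc 0 T, jacB F (x t) (u t) (p t) = drift F (x t) (u t))
    (hpn : ∀ t ∈ Icc 0 T, ‖p t‖ ≤ Lx * ‖x t‖ + Lu * ‖u t‖) {s : ℝ} (hs : s ∈ Icc 0 T) :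
    (∫ t in s..T, (‖x t‖ ^ 2 + αR / αQ * ‖u t‖ ^ 2)) + αV / αQ * ‖x T‖ ^ 2 ≤
      constC1 γ αQ βQ βR βV * ‖x s‖ ^ 2 + 2 * constC2 αQ αR βR Lx Lu * ε ^ 2 := by
  have hβR : 0 < βR := hαR.trans_le hαβR
  have hsT : s ≤ T := hs.2
  have hIcc : Icc s T ⊆ Icc 0 T := Icc_subset_Icc_left hs.1
  set b := max βV (max βR βQ) with hb
  have hbV : βV ≤ b := le_max_left _ _
  have hbR : βR ≤ b := (le_max_left _ _).trans (le_max_right _ _)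
  have hbQ : βQ ≤ b := (le_max_right _ _).trans (le_max_right _ _)
  have hb0 : 0 < b := hβR.trans_le hbR
  set θ := 8 * βR * max (Lx ^ 2 / αQ) (Lu ^ 2 / αR) with hθ
  have hθ0 : 0 ≤ θ := by
    have : 0 ≤ max (Lx ^ 2 / αQ) (Lu ^ 2 / αR) := le_max_of_le_left (by positivity)
    positivity
  have hθ1 : θ ≤ 1 := mul_max_le_one hαQ hαR hβR hLu' hLx'
  have hua := hu.1.mono hIcc
  have hxs : ContinuousOn x (Icc s T) := hx.continuousOn.mono hIcc
  have hsm : s ∈ Icc s T := left_mem_Icc.2 hsT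
  have hTm : T ∈ Icc s T := right_mem_Icc.2 hsT
  have hQR : Continuous fun p : Euc n × Euc m => Q p.1 + R p.2 :=
    (hQ.contDiff.continuous.comp continuous_fst).add (hR.contDiff.continuous.comp continuous_snd)
  have hcI : Continuous fun p : Euc n × Euc m => αQ * ‖p.1‖ ^ 2 + αR * ‖p.2‖ ^ 2 := by fun_prop
  have hcz : Continuous fun p : Euc n × Euc m => ‖p.1‖ ^ 2 + ‖p.2‖ ^ 2 := by fun_prop
  set I := ∫ t in s..T, (αQ * ‖x t‖ ^ 2 + αR * ‖u t‖ ^ 2) with hI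
  have iI : IntervalIntegrable (fun t => αQ * ‖x t‖ ^ 2 + αR * ‖u t‖ ^ 2) volume s T :=
    (memLp_top_comp hcI hxs hua).intervalIntegrable_of_top hsm hTm
  have hI0 : 0 ≤ I := intervalIntegral.integral_nonneg hsT fun _ _ => by positivity
  have key : ∀ c, γ * ‖x s‖ ^ 2 < c →
      (1 / 2 - θ / 4) * I + αV / 2 * ‖x T‖ ^ 2 ≤ b * c + ε ^ 2 / (2 * αR) := fun c hc => by
    obtain ⟨v, z, hv, hz, hlt⟩ := hstab.exists_lt hs (x s) hc
    have h1 := cost_le_linearized_cost hF hLF hFLip hαQ hQ hαR hR hαV hV hu hs hx hpa hp hv hz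
    have hvp : AdmissibleInput s T fun t => v t - p t := MemLp.sub hv (hpa.mono hIcc)
    have h2 : 1 / 2 * I ≤ ∫ t in s..T, (Q (x t) + R (u t)) := by
      rw [hI, ← intervalIntegral.integral_const_mul]
      refine intervalIntegral.integral_mono_on hsT (iI.const_mul _)
        ((memLp_top_comp hQR hxs hua).intervalIntegrable_of_top hsm hTm) fun t _ => ?_
      linarith [hQ.le_at (x t), hR.le_at (u t)]
    have iz : IntervalIntegrable (fun t => ‖z t‖ ^ 2 + ‖v t‖ ^ 2) volume s T :=
      (memLp_top_comp hcz hz.continuousOn hv).intervalIntegrable_of_top hsm hTm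
    have h3 : ∫ t in s..T, (Q (z t) + R (v t - p t)) ≤
        b * (∫ t in s..T, (‖z t‖ ^ 2 + ‖v t‖ ^ 2)) + θ / 4 * I := by
      rw [hI, ← intervalIntegral.integral_const_mul, ← intervalIntegral.integral_const_mul,
        ← intervalIntegral.integral_add (iz.const_mul _) (iI.const_mul _)]
      refine intervalIntegral.integral_mono_on hsT
        ((memLp_top_comp hQR hz.continuousOn hvp).intervalIntegrable_of_top hsm hTm)
        ((iz.const_mul _).add (iI.const_mul _)) fun t ht => ?_
      have e1 := hQ.at_le (z t)
      have e2 := hR.at_le (v t - p t)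
      have e3 : ‖v t - p t‖ ^ 2 ≤ 2 * ‖v t‖ ^ 2 + 2 * ‖p t‖ ^ 2 := by
        have f1 : ‖v t - p t‖ ^ 2 ≤ (‖v t‖ + ‖p t‖) ^ 2 := by
          gcongr; exact norm_sub_le _ _
        nlinarith [sq_nonneg (‖v t‖ - ‖p t‖)]
      have e4 : βR * ‖p t‖ ^ 2 ≤ θ / 4 * (αQ * ‖x t‖ ^ 2 + αR * ‖u t‖ ^ 2) :=
        mul_sq_le_of_le_add hαQ hαR hβR (norm_nonneg _) (hpn t (hIcc ht))
      have e5 : βQ / 2 * ‖z t‖ ^ 2 ≤ b * ‖z t‖ ^ 2 := by gcongr; linarith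
      have e6 : βR * ‖v t‖ ^ 2 ≤ b * ‖v t‖ ^ 2 := by gcongr
      have e7 := mul_le_mul_of_nonneg_left e3 hβR.le
      linarith
    have h4 : V (z T) ≤ b * ‖z T‖ ^ 2 := (hV.at_le (z T)).trans (by gcongr; linarith)
    have h5 := hV.le_at (x T)
    have h6 := mul_le_mul_of_nonneg_left hlt.le hb0.le
    linarith
  -- The stabilizing infimum need not be attained, so the value `γ‖x s‖²` is reached only in the
  -- limit.
  have key2 : (1 / 2 - θ / 4) * I + αV / 2 * ‖x T‖ ^ 2 ≤
      b * (γ * ‖x s‖ ^ 2) + ε ^ 2 / (2 * αR) := by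
    refine le_of_forall_pos_le_add fun η hη => ?_
    have h1 := key (γ * ‖x s‖ ^ 2 + η / b) (lt_add_of_pos_right _ (by positivity))
    rw [mul_add, mul_div_cancel₀ _ hb0.ne'] at h1
    linarith
  have hIeq : ∫ t in s..T, (‖x t‖ ^ 2 + αR / αQ * ‖u t‖ ^ 2) = I / αQ := by
    rw [div_eq_inv_mul I, hI, ← intervalIntegral.integral_const_mul]
    congr 1
    ext t
    field_simp
  rw [hIeq]
  calc I / αQ + αV / αQ * ‖x T‖ ^ 2 = (I + αV * ‖x T‖ ^ 2) / αQ := by ring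
    _ ≤ _ := scaled_energy_bound hαQ hαR hγ hb0 hθ0 hθ1 hI0 (by positivity) (sq_nonneg ‖x s‖)
      (by linarith)

end Energy

/-! ### The main estimate -/

theorem mainTheorem1 {n m : ℕ} (F : Euc n × Euc m → Euc n)
    (Q : Euc n → ℝ) (R : Euc m → ℝ) (V : Euc n → ℝ)
    (LF αQ βQ αR βR αV βV γ Lx Lu : ℝ)
    -- regularity of the vector field, and the equilibrium at the origin
    (hF : ContDiff ℝ 1 F) (hLF : 0 < LF)
    (hFLip : ∀ x₁ x₂ u₁ u₂, ‖F (x₁, u₁) - F (x₂, u₂)‖ ≤ LF * (‖x₁ - x₂‖ + ‖u₁ - u₂‖))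
    (hF0 : F (0, 0) = 0)
    -- the costs
    (hαQ : 0 < αQ) (hαβQ : αQ ≤ βQ) (hQ : IsCost αQ βQ Q)
    (hαR : 0 < αR) (hαβR : αR ≤ βR) (hR : IsCost αR βR R)
    (hαV : 0 ≤ αV) (hαβV : αV ≤ βV) (hV : IsCost αV βV V)
    -- matching condition
    (hmatch : ∀ (T : ℝ) (x₀ : Euc n) (u : ℝ → Euc m) (x : ℝ → Euc n), 0 ≤ T →
      AdmissibleInput 0 T u → IsTrajectory F T x₀ u x →
      ∀ t ∈ Set.Icc 0 T, drift F (x t) (u t) ∈ Set.range (jacB F (x t) (u t)))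
    -- uniform stabilizability of the Jacobian linearizations
    (hγ : 0 < γ)
    (hstab : ∀ (T : ℝ) (x₀ : Euc n) (u : ℝ → Euc m) (x : ℝ → Euc n), 0 ≤ T →
      AdmissibleInput 0 T u → IsTrajectory F T x₀ u x →
      IsStabilizable γ T (fun t => jacA F (x t) (u t)) (fun t => jacB F (x t) (u t)))
    -- drift bound
    (hLx : 0 < Lx) (hLu : 0 < Lu)
    (hdrift : ∀ (T : ℝ) (x₀ : Euc n) (u : ℝ → Euc m) (x : ℝ → Euc n), 0 ≤ T →
      AdmissibleInput 0 T u → IsTrajectory F T x₀ u x →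
      ∀ t ∈ Set.Icc 0 T,
        ‖pinv (jacB F (x t) (u t)) (drift F (x t) (u t))‖ ≤ Lx * ‖x t‖ + Lu * ‖u t‖)
    -- smallness of the drift constants
    (hLu' : Lu ^ 2 ≤ αR / (8 * βR)) (hLx' : Lx ^ 2 ≤ αQ / (8 * βR))
    -- an approximate first-order stationary point and its trajectory
    (T : ℝ) (hT : 0 ≤ T) (x₀ : Euc n) (ε : ℝ) (u : ℝ → Euc m)
    (hu : IsFOS T ε (cost F Q R V T x₀) u)
    (x : ℝ → Euc n) (hx : IsTrajectory F T x₀ u x) :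
    (0 < αV → ∀ s ∈ Set.Icc 0 T,
      ‖x s‖ ^ 2 ≤ constC0 LF αQ αR αV *
        (constC1 γ αQ βQ βR βV * Real.exp (-(s / constC1 γ αQ βQ βR βV)) * ‖x₀‖ ^ 2
          + constC2 αQ αR βR Lx Lu * ε ^ 2)) ∧
    (∀ s ∈ Set.Icc 0 T, ∀ δ : ℝ, 0 < δ →
      ‖x s‖ ^ 2 ≤ constC0δ LF αQ αR δ *
        (Real.exp (δ / constC1 γ αQ βQ βR βV) * constC1 γ αQ βQ βR βV
            * Real.exp (-(s / constC1 γ αQ βQ βR βV)) * ‖x₀‖ ^ 2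
          + constC2 αQ αR βR Lx Lu * ε ^ 2)) := by
  have hβR : 0 < βR := hαR.trans_le hαβR
  have hua := hu.1
  have hpn := hdrift T x₀ u x hT hua hx
  have hC1 : 0 < constC1 γ αQ βQ βR βV := constC1_pos hγ hαQ hβR
  have hC2 : 0 < constC2 αQ αR βR Lx Lu := constC2_pos hαQ hαR hβR
  have hW : ∀ s ∈ Icc 0 T, _ := fun s hs =>
    energy_le hF hLF hFLip hαQ hQ hαR hαβR hR hαV hV hLu' hLx' hγ hu hx
      (hstab T x₀ u x hT hua hx)
      (admissibleInput_pinv_drift hF hua hx.continuousOn hLx hLu hpn)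
      (fun t ht => apply_pinv_of_mem_range _ (hmatch T x₀ u x hT hua hx t ht)) hpn hs
  -- lower bounds on the first constant
  have hC1R : 4 * γ * (αR / αQ) ≤ constC1 γ αQ βQ βR βV := by
    rw [constC1, ← mul_div_assoc]
    have : αR ≤ max βV (max βR βQ) :=
      hαβR.trans ((le_max_left _ _).trans (le_max_right _ _))
    gcongr
  have hC1Q : 4 * γ ≤ constC1 γ αQ βQ βR βV := by
    rw [constC1, le_div_iff₀ hαQ]
    have : αQ ≤ max βV (max βR βQ) :=
      hαβQ.trans ((le_max_right _ _).trans (le_max_right _ _))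
    gcongr
  -- Stabilizability holds for every horizon, not just `T`; the equilibrium trajectory at horizons
  -- `0` and `4γ` yields the lower bounds on `γ`. A nonzero `x₀` serves as the test vector.
  have hstab0 : ∀ S : ℝ, 0 ≤ S → _ := fun S hS =>
    hstab S 0 (fun _ => 0) (fun _ => 0) hS (MemLp.zero' (p := ∞)) (isTrajectory_zero hF0 S)
  have hγ1 : x₀ ≠ 0 → 1 ≤ γ := fun h => one_le_of_isStabilizable (hstab0 0 le_rfl) h
  have hγL : x₀ ≠ 0 → 1 ≤ 12 * LF * γ := fun h =>
    one_le_mul_of_isStabilizable hLF hγ (fun t y => norm_jacA_apply_le hLF hFLip _ _ _)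
      (fun t y => norm_jacB_apply_le hLF hFLip _ _ _) (hstab0 (4 * γ) (by positivity)) h
  have hx0 : x 0 = x₀ := by simpa using hx.eq_integral 0 (left_mem_Icc.2 hT)
  set C := constC1 γ αQ βQ βR βV
  set D := constC2 αQ αR βR Lx Lu
  -- Chosen so that `K w` dominates `LF (3‖x‖² + ‖u‖²)`: the first summand covers the state, the
  -- second cancels the weight `αR / αQ` on the input.
  set K := 3 * LF + LF * (αQ / αR) with hKdef
  have hK : 0 < K := by positivity
  set w : ℝ → ℝ := fun t => ‖x t‖ ^ 2 + αR / αQ * ‖u t‖ ^ 2 with hwdef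
  have hw0 : ∀ t, 0 ≤ w t := fun t => by positivity
  have hqw : ∀ t, ‖x t‖ ^ 2 ≤ w t := fun t => le_add_of_nonneg_right (by positivity)
  have hcw : Continuous fun p : Euc n × Euc m => ‖p.1‖ ^ 2 + αR / αQ * ‖p.2‖ ^ 2 := by fun_prop
  have hwL := memLp_top_comp hcw hx.continuousOn hua
  have iw : ∀ a ∈ Icc 0 T, ∀ b ∈ Icc 0 T, IntervalIntegrable w volume a b := fun a ha b hb =>
    hwL.intervalIntegrable_of_top ha hb
  have hTm : T ∈ Icc 0 T := right_mem_Icc.2 hT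
  have h0m : (0 : ℝ) ∈ Icc 0 T := left_mem_Icc.2 hT
  have hdecay := tail_integral_le_exp_decay (q := fun t => ‖x t‖ ^ 2) hC1
    (hwL.integrable (by simp)) (fun t _ => hqw t) hW
  simp only [hx0] at hdecay
  have hc0 : 0 ≤ αV / αQ * ‖x T‖ ^ 2 := by positivity
  have hE : 0 ≤ D * ε ^ 2 := by positivity
  have hX0 : 0 ≤ ‖x₀‖ ^ 2 := by positivity
  -- variation of the squared norm along the trajectory
  have hvar : ∀ a ∈ Icc 0 T, ∀ b ∈ Icc 0 T, a ≤ b →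
      |‖x b‖ ^ 2 - ‖x a‖ ^ 2| ≤ K * ∫ τ in a..b, w τ := fun a ha b hb hab => by
    refine (IsSolution.abs_norm_sq_sub_le hx hua hLF.le (fun τ => by
      simpa [hF0] using hFLip (x τ) 0 (u τ) 0) ha hb hab).trans ?_
    rw [← intervalIntegral.integral_const_mul, ← intervalIntegral.integral_const_mul]
    have hc3 : Continuous fun p : Euc n × Euc m => 3 * ‖p.1‖ ^ 2 + ‖p.2‖ ^ 2 := by fun_prop
    refine intervalIntegral.integral_mono_on hab
      (((memLp_top_comp hc3 hx.continuousOn hua).intervalIntegrable_of_top ha hb).const_mul LF)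
      ((iw a ha b hb).const_mul K) fun t _ => ?_
    have e1 : K * w t = LF * (3 * ‖x t‖ ^ 2 + ‖u t‖ ^ 2) + LF * (αQ / αR) * ‖x t‖ ^ 2
        + 3 * LF * (αR / αQ) * ‖u t‖ ^ 2 := by
      simp only [hKdef, hwdef]; field_simp; ring
    rw [e1]
    have e2 : 0 ≤ LF * (αQ / αR) * ‖x t‖ ^ 2 := by positivity
    have e3 : 0 ≤ 3 * LF * (αR / αQ) * ‖u t‖ ^ 2 := by positivity
    linarith
  have hinit : ∀ s ∈ Icc 0 T, ‖x s‖ ^ 2 ≤ ‖x₀‖ ^ 2 + K * (C * ‖x₀‖ ^ 2 + 2 * D * ε ^ 2) :=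
    fun s hs => by
    have h1 := (le_abs_self _).trans (hvar 0 h0m s hs hs.1)
    rw [hx0] at h1
    have h2 : ∫ τ in (0 : ℝ)..s, w τ ≤ ∫ τ in (0 : ℝ)..T, w τ :=
      intervalIntegral.integral_mono_interval le_rfl hs.1 hs.2 (Eventually.of_forall hw0)
        (iw 0 h0m T hTm)
    have h3 := hdecay 0 h0m
    simp only [zero_div, neg_zero, Real.exp_zero, mul_one] at h3
    have h4 : K * ∫ τ in (0 : ℝ)..s, w τ ≤ K * (C * ‖x₀‖ ^ 2 + 2 * D * ε ^ 2) := by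
      gcongr; linarith
    linarith
  have havg : ∀ s ∈ Icc 0 T, ∀ σ, 0 < σ → σ ≤ s → ‖x s‖ ^ 2 ≤ (K + 1 / σ) *
      (C * (Real.exp (σ / C) * Real.exp (-(s / C))) * ‖x₀‖ ^ 2 + 2 * D * ε ^ 2) :=
    fun s hs σ hσ hσs => by
    have hr : s - σ ∈ Icc 0 T := ⟨by linarith, by linarith [hs.2]⟩
    have h1 := le_mul_integral_of_sub_le (q := fun t => ‖x t‖ ^ 2) (by linarith : s - σ < s) hK.le
      (iw _ hr s hs) hw0 hqw fun t ht => by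
        have ht' : t ∈ Icc 0 T := ⟨hr.1.trans ht.1, ht.2.trans hs.2⟩
        linarith [(le_abs_self _).trans (hvar t ht' s hs ht.2)]
    rw [sub_sub_cancel] at h1
    have h2 : ∫ τ in (s - σ)..s, w τ ≤ ∫ τ in (s - σ)..T, w τ :=
      intervalIntegral.integral_mono_interval le_rfl (by linarith) hs.2
        (Eventually.of_forall hw0) (iw _ hr T hTm)
    have h3 := hdecay _ hr
    rw [show -((s - σ) / C) = σ / C + -(s / C) by ring, Real.exp_add] at h3
    refine h1.trans ?_
    gcongr
    linarith
  refine ⟨fun hαV s hs => ?_, fun s hs δ hδ => ?_⟩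
  -- Integrate backwards from `T`: the weight `αV / αQ` on the terminal energy costs the factor `αQ
  -- / αV`.
  · have h1 := (neg_abs_le _).trans' (neg_le_neg (hvar s hs T hTm hs.2))
    have h2 := hdecay s hs
    have h3 : constC0 LF αQ αR αV = 2 * (K + αQ / αV) := by
      rw [constC0, hKdef]; ring
    have hI0 : 0 ≤ ∫ τ in s..T, w τ := intervalIntegral.integral_nonneg hs.2 fun t _ => hw0 t
    have h4 : ‖x s‖ ^ 2 ≤ (K + αQ / αV) * ((∫ τ in s..T, w τ) + αV / αQ * ‖x T‖ ^ 2) := by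
      have e1 : (K + αQ / αV) * ((∫ τ in s..T, w τ) + αV / αQ * ‖x T‖ ^ 2) =
          ‖x T‖ ^ 2 + K * (∫ τ in s..T, w τ) + (αQ / αV * (∫ τ in s..T, w τ)
            + K * (αV / αQ * ‖x T‖ ^ 2)) := by field_simp; ring
      rw [e1]
      have e2 : 0 ≤ αQ / αV * (∫ τ in s..T, w τ) + K * (αV / αQ * ‖x T‖ ^ 2) := by positivity
      linarith
    have hM : 0 ≤ C * Real.exp (-(s / C)) * ‖x₀‖ ^ 2 := by positivity
    have hKV : 0 ≤ K + αQ / αV := by positivity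
    rw [h3]
    calc ‖x s‖ ^ 2 ≤ _ := h4
      _ ≤ (K + αQ / αV) * (C * Real.exp (-(s / C)) * ‖x₀‖ ^ 2 + 2 * D * ε ^ 2) := by gcongr
      _ ≤ (K + αQ / αV) * (2 * (C * Real.exp (-(s / C)) * ‖x₀‖ ^ 2 + D * ε ^ 2)) := by
        gcongr; linarith
      _ = _ := by ring
  -- The second argument of the minimum corresponds to an averaging window of length `ρ = αR / αQ`.
  · have h3 : constC0δ LF αQ αR δ = 2 * K + min (2 / δ) (2 * (1 / (αR / αQ))) := by
      rw [constC0δ, hKdef, one_div_div, mul_div_assoc 2 αQ αR]; ring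
    rw [h3]
    refine le_of_average_bounds hK hC1 hE hX0 hδ (by positivity) ?_ (fun h => ?_)
      (by linarith [hinit s hs]) (fun σ hσ hσs => by linarith [havg s hs σ hσ hσs])
    · rcases eq_or_ne x₀ 0 with h | h
      · simp [h]
      have e2 : 3 * LF * (4 * γ) ≤ K * C :=
        mul_le_mul (le_add_of_nonneg_right (by positivity)) hC1Q (by positivity) hK.le
      exact le_mul_of_one_le_left hX0 (by linarith [hγL h])
    · have hx₀ : x₀ ≠ 0 := fun h0 => h (by simp [h0])
      have e1 := mul_le_mul_of_nonneg_right (hγ1 hx₀) (by positivity : 0 ≤ αR / αQ)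
      linarith
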